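/- **Setting.** Let $d\in\{1,2\}$, let $n,W$ be odd positive integers, $L=nW$, $N=L^d$, and let $\lambda>0$. On the torus of blocks $\mathbb T=(\mathbb Z/n\mathbb Z)^d$ let $\Delta$ be the lattice Laplacian, $(\Delta f)(x)=\sum_{i=1}^d\big(2f(x)-f(x+e_i)-f(x-e_i)\big)$, and $$S=(1+2d\lambda^2)^{-1}\big[I+\lambda^2(2d\,I-\Delta)\big].$$ Let $m(z)=\tfrac12(-z+\sqrt{z^2-4})$, with $\operatorname{Im} m(z)>0$ for $\operatorname{Im} z>0$, be the Stieltjes transform of the semicircle law, and for $x\in\mathbb R$ let $m(x)=m(x+\mathrm i0_+)$ and $\kappa_x=\min(|x-2|,|x+2|)$. For $\mathfrak c>0$ let $$\eta_*(E)=\begin{cases}\inf\{\eta>0:\ N\eta\sqrt{\kappa_E+\eta}\ge1,\ W^2\eta(\kappa_E+\eta)^{3/2}\ge1\}, & |E|\le2,\ d=1,\\ \inf\{\eta>0:\ N\eta\sqrt{\kappa_E+\eta}\ge1,\ W^2(\kappa_E+\eta)\ge W^{\mathfrak c}\}, & |E|\le2,\ d=2,\\ \inf\{\eta>0:\ N\eta^2/\sqrt{\kappa_E+\eta}\ge1,\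 W^d\eta^2/(\kappa_E+\eta)^{1/2+d/4}\ge1\}, & |E|>2,\end{cases}$$ and for $C_0>2$, $\mathfrak d>0$ let $\mathbf D=\{z=E+\mathrm i\eta:\ \eta>0,\ |E|\le C_0,\ W^{\mathfrak d}\eta_*(E)\le\eta\le1\}$. For $z\in\mathbf D$ put $$t_0=|m(z)|^2,\qquad \mathsf E=-2\,\frac{\operatorname{Re}m(z)}{|m(z)|},\qquad m=m(\mathsf E),\qquad \kappa=\kappa_{\mathsf E},$$ $$\omega_t=|1-t|+\sqrt\kappa,\qquad \ell_t=\min(|1-t|^{-1/2},n).$$ Write $m(+)=m$, $m(-)=\overline m$. The primitive loops $\mathcal K^{(\mathfrak n)}_{t,\boldsymbol\sigma,\mathbf a}$ ($\mathfrak n\ge1$, $t\in[0,1)$, $\boldsymbol\sigma\in\{+,-\}^{\mathfrak n}$, $\mathbf a\in\mathbb T^{\mathfrak n}$) are the solution of the following system: $\mathcal K^{(1)}_{t,\sigma,a}=m(\sigma)$, and for $\mathfrak n\ge2$ $$\frac{\mathrm d}{\mathrm dt}\mathcal K^{(\mathfrak n)}_{t,\boldsymbol\sigma,\mathbf a}=W^d\sum_{1\le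 k<l\le\mathfrak n}\ \sum_{a,b\in\mathbb T}\mathcal K^{(\mathfrak n+k-l+1)}_{t,(\sigma_1,\ldots,\sigma_k,\sigma_l,\ldots,\sigma_{\mathfrak n}),(a_1,\ldots,a_{k-1},a,a_l,\ldots,a_{\mathfrak n})}\,S_{ab}\,\mathcal K^{(l-k+1)}_{t,(\sigma_k,\ldots,\sigma_l),(a_k,\ldots,a_{l-1},b)},$$ $$\mathcal K^{(\mathfrak n)}_{0,\boldsymbol\sigma,\mathbf a}=W^{-(\mathfrak n-1)d}\prod_{i=1}^{\mathfrak n}m(\sigma_i)\,\mathbf 1(a_1=\cdots=a_{\mathfrak n}).$$ **Lemma (estimates of $\mathcal K$-loops).** Fix $d\in\{1,2\}$, $\mathfrak n\ge2$ and constants $C>0$, $C_0>2$, $\delta,\mathfrak d,\mathfrak c>0$. For every $\tau>0$ there is an $N_0$, depending only on these constants and $\tau$, such that the following holds whenever $N\ge N_0$, $W\ge L^\delta$, $C^{-1}\le\lambda\le C$ and $z\in\mathbf D$: the above system has exactly one solution on $[0,1)$, and for all $t\in[0,t_0]$ $$\max_{\boldsymbol\sigma\in\{+,-\}^{\mathfrak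 n},\ \mathbf a\in\mathbb T^{\mathfrak n}}\big|\mathcal K^{(\mathfrak n)}_{t,\boldsymbol\sigma,\mathbf a}\big|\ \le\ N^{\tau}\,\frac{\omega_t}{\big(W^d\,\ell_t^d\,|1-t|\,\omega_t\big)^{\mathfrak n-1}}.$$ -/

import Mathlib

open scoped ComplexConjugate

noncomputable section

/-- The Stieltjes transform `m(z) = (-z + √(z² - 4)) / 2` of the semicircle law. The square root is
written as `√(z - 2) √(z + 2)` with principal roots, which is the branch with `Im m(z) > 0` on the
open upper half plane; at a real point `x` the same formula gives the boundary value
`m(x + i 0₊)`, since the principal root is continuous from above on the negative axis. -/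
def msc (z : ℂ) : ℂ :=
  (-z + (z - 2) ^ (1 / 2 : ℂ) * (z + 2) ^ (1 / 2 : ℂ)) / 2

/-- The defining quadratic equation `m² + z m + 1 = 0`, i.e. `z = -m - 1 / m`. -/
theorem msc_quadratic (z : ℂ) : msc z ^ 2 + z * msc z + 1 = 0 := by
  have h (x : ℂ) : (x ^ (1 / 2 : ℂ)) ^ 2 = x := by simp
  have h1 := h (z - 2)
  have h2 := h (z + 2)
  unfold msc
  linear_combination (1 / 4 : ℂ) * ((z + 2) ^ (1 / 2 : ℂ)) ^ 2 * h1 + (1 / 4 : ℂ) * (z - 2) * h2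

/-- Distance `κ_E = |E - 2| ∧ |E + 2|` of a real energy to the spectral edges. -/
def edgeDist (E : ℝ) : ℝ := min |E - 2| |E + 2|

/-- The threshold `η_*(E)`, where `L = n W` and `N = L ^ d`. -/
def etaStar (d n W : ℕ) (c E : ℝ) : ℝ :=
  if |E| ≤ 2 then
    if d = 1 then
      sInf {η : ℝ | 0 < η ∧ 1 ≤ (((n * W) ^ d : ℕ) : ℝ) * η * √(edgeDist E + η) ∧
        1 ≤ (W : ℝ) ^ 2 * η * (edgeDist E + η) ^ (3 / 2 : ℝ)}
    else
      sInf {η : ℝ | 0 < η ∧ 1 ≤ (((n * W) ^ d : ℕ) : ℝ) * η * √(edgeDist E + η) ∧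
        (W : ℝ) ^ c ≤ (W : ℝ) ^ 2 * (edgeDist E + η)}
  else
    sInf {η : ℝ | 0 < η ∧ 1 ≤ (((n * W) ^ d : ℕ) : ℝ) * η ^ 2 / √(edgeDist E + η) ∧
      1 ≤ (W : ℝ) ^ d * η ^ 2 / (edgeDist E + η) ^ (1 / 2 + d / 4 : ℝ)}

/-- The spectral domain of the target parameters `z = E + i η`:
`η > 0`, `|E| ≤ C₀` and `W ^ b * η_*(E) ≤ η ≤ 1`. -/
def spectralDomain (d n W : ℕ) (C₀ b c : ℝ) : Set ℂ :=
  {z : ℂ | 0 < z.im ∧ |z.re| ≤ C₀ ∧ (W : ℝ) ^ b * etaStar d n W c z.re ≤ z.im ∧ z.im ≤ 1}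

/-- The final time `t₀ = |m(z)|²` of the flow that ends at `z`. -/
def flowTime (z : ℂ) : ℝ := ‖msc z‖ ^ 2

/-- The (real) flow parameter `-2 Re m(z) / |m(z)|` of the flow that ends at `z`. -/
def flowEnergy (z : ℂ) : ℝ := -2 * (msc z).re / ‖msc z‖

/-- `ω_t = |1 - t| + √κ`, for the flow with flow parameter `E`, where `κ = κ_E`. -/
def omegaT (E t : ℝ) : ℝ := |1 - t| + √(edgeDist E)

/-- `ℓ_t = min (|1 - t| ^ (-1/2)) n`. -/
def ellT (n : ℕ) (t : ℝ) : ℝ := min (|1 - t| ^ (-(1 / 2) : ℝ)) n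

/-- The lattice of blocks, a discrete torus of side length `n` in dimension `d`. -/
abbrev BlockTorus (d n : ℕ) : Type := Fin d → ZMod n

/-- The (positive) periodic lattice Laplacian `(Δ f)(x) = ∑ᵢ (2 f(x) - f(x + eᵢ) - f(x - eᵢ))`. -/
def blockLaplacian (d n : ℕ) : Matrix (BlockTorus d n) (BlockTorus d n) ℝ :=
  Matrix.of fun x y => ∑ i : Fin d,
    (2 * (if y = x then 1 else 0) - (if y = x + Pi.single i 1 then 1 else 0)
      - (if y = x - Pi.single i 1 then 1 else 0))

/-- The variance matrix projected to the lattice of blocks,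
`(1 + 2 d λ²)⁻¹ (I + λ² (2 d I - Δ))`. Its entries are `(1 + 2 d λ²)⁻¹` on the diagonal and
`λ² (1 + 2 d λ²)⁻¹` at pairs of neighbouring blocks (for `n ≥ 3`), and its row sums are `1`. -/
def blockVariance (d n : ℕ) (lam : ℝ) : Matrix (BlockTorus d n) (BlockTorus d n) ℝ :=
  (1 + 2 * (d : ℝ) * lam ^ 2)⁻¹ •
    (1 + lam ^ 2 • ((2 * (d : ℝ)) • (1 : Matrix (BlockTorus d n) (BlockTorus d n) ℝ)
      - blockLaplacian d n))

/-- The indices `(σ, a)` of a loop of length `r`, as the list `(σ₁, a₁), …, (σᵣ, aᵣ)` of length `r`;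
the charge `+` is `true`, the charge `-` is `false`. -/
abbrev LoopIndex (d n : ℕ) : Type := List (Bool × BlockTorus d n)

/-- `m(+) = m` and `m(-)` is the complex conjugate of `m`. -/
def chargedM (m : ℂ) (s : Bool) : ℂ := if s then m else conj m

/-- The left cut at the positions `k < l` (counted from `0`):
`(σ₁ … σ_k σ_l … σᵣ, a₁ … a_{k-1} a a_l … aᵣ)`. -/
def cutLeft {d n : ℕ} (w : LoopIndex d n) (k l : Fin w.length) (a : BlockTorus d n) :
    LoopIndex d n :=
  w.take k ++ ((w.get k).1, a) :: w.drop l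

/-- The right cut at the positions `k < l` (counted from `0`):
`(σ_k … σ_l, a_k … a_{l-1} b)`. -/
def cutRight {d n : ℕ} (w : LoopIndex d n) (k l : Fin w.length) (b : BlockTorus d n) :
    LoopIndex d n :=
  (w.take l).drop k ++ [((w.get l).1, b)]

/-- The `M`-loop `W ^ (-(r - 1) d) * ∏ᵢ m(σᵢ) * 1(a₁ = ⋯ = aᵣ)`. -/
def mLoop {d n : ℕ} (W : ℕ) (m : ℂ) (w : LoopIndex d n) : ℂ :=
  if ∀ x ∈ w, ∀ y ∈ w, x.2 = y.2 then
    (((W : ℂ) ^ d)⁻¹) ^ (w.length - 1) * (w.map fun x => chargedM m x.1).prod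
  else 0

/-- The right-hand side of the primitive equation, for the values `F` of all loops at one time:
`W ^ d ∑_{k < l} ∑_{a, b} F(Cut_L) S_{ab} F(Cut_R)`. -/
def primitiveRHS {d n : ℕ} [NeZero n] (W : ℕ) (lam : ℝ) (F : LoopIndex d n → ℂ)
    (w : LoopIndex d n) : ℂ :=
  (W : ℂ) ^ d * ∑ k : Fin w.length, ∑ l ∈ Finset.univ.filter (fun l => k < l),
    ∑ a : BlockTorus d n, ∑ b : BlockTorus d n,
      F (cutLeft w k l a) * (blockVariance d n lam a b : ℂ) * F (cutRight w k l b)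

/-- `K` is the family of primitive loops on the time interval `[0, 1)`, for the value `m` of the
semicircle transform at the flow parameter: `K t w` is the primitive loop with index `w` at time
`t`. The value at the empty list and the times outside `[0, 1)` play no role. -/
structure IsPrimitiveLoopFamily {d n : ℕ} [NeZero n] (W : ℕ) (lam : ℝ) (m : ℂ)
    (K : ℝ → LoopIndex d n → ℂ) : Prop where
  one_loop : ∀ t ∈ Set.Ico (0 : ℝ) 1, ∀ s a, K t [(s, a)] = chargedM m s
  initial : ∀ w : LoopIndex d n, 2 ≤ w.length → K 0 w = mLoop W m w
  equation : ∀ w : LoopIndex d n, 2 ≤ w.length → ∀ t ∈ Set.Ico (0 : ℝ) 1,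
    HasDerivWithinAt (fun u => K u w) (primitiveRHS W lam (K t) w) (Set.Ico (0 : ℝ) 1) t

end

/-! The powers of `W` scale out: a loop of length `r` is `W ^ (-(r - 1) d)` times a `W`-free
quantity, seen as a function of its last site `x`. For a fixed word let `M_ij(x)` be this quantity
for the stretch from position `i` to `j`, and write `μ_i = m(σ_i)`.

Existence. The hierarchy is not integrated. Instead `M` is defined at each fixed `t` by recursion on
the length, `M_ij(x) = μ_i [1(a_i = x) M_{i+1,j}(x) + t ∑_{i<p≤j} (S M_ip)(x) M_pj(x)]`, where the
term `p = j` contains the unknown and is removed by inverting `1 - t μ_i μ_j S`. The time derivative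
of `M` and the sum over cuts satisfy the same differentiated recursion, so they agree by induction
(`IsSymbol.derivSubchain_eq_primitiveSum`). Uniqueness is Grönwall's inequality, length by length,
because a cut never lengthens a loop (`IsPrimitiveLoopFamily.eq`).

Estimate. Let `s` be the Fourier symbol of `S`, `b` the diagonal entry of `(1 - t S)⁻¹` and `ω = 1 -
t + √κ`. The claim, for a stretch of length `L`, is `(1 - t s(χ)) |M̂_{0L}(χ)| ≲ (b / ω) ^ (L - 1)`;
summing over `χ` then gives `|M_{0L}(x)| ≲ b (b / ω) ^ (L - 1)`. Such bounds survive products at the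
cost of a factor `b`, because `1 - s` is subadditive up to a factor 2 (`ResolventBound.mul`). In the
induction on `L` there are two cases.

If the two end charges agree, the operator to invert is `1 - t m² S` or its conjugate, whose symbol
is at least a multiple of `ω` (`IsSymbol.norm_one_sub_sq_ge`). If they differ, it is `1 - t S`
itself, with gap only `1 - t`. This is harmless when `√κ ≤ 1 - t`. Otherwise a Ward identity
(`IsSymbol.ward`) expresses `(μ_L - μ_0) (1 - t S) M_{0L}` by shorter chains, each product having a
factor of the form `(1 - t S) M`, and `|μ_L - μ_0| = 2 |Im m|` is comparable to `√κ`. The Ward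
identity is the difference of the recursion and its mirror image, which starts from the last vertex.
The mirror image holds because the recursion exhibits a left inverse of the matrix `(M_ij(x))`, and
a left inverse of a square matrix is a right inverse (`IsSymbol.subchain_eq_mirror`).

Finally `b ≲ (1 + log n)² / (ℓ ^ d (1 - t))` in dimensions one and two (`resolventDiag_le`), and the
logarithms are absorbed by `N ^ τ`. -/

noncomputable section

/-! ### Real kernels acting on functions -/

section Action

variable {G : Type*} [Fintype G]

/-- The action of a real kernel on a function. -/
def act (S : Matrix G G ℝ) (f : G → ℂ) (x : G) : ℂ := ∑ y, (S x y : ℂ) * f y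

theorem act_sub (S : Matrix G G ℝ) (f g : G → ℂ) (x : G) :
    act S (fun y => f y - g y) x = act S f x - act S g x := by
  simp [act, mul_sub, Finset.sum_sub_distrib]

theorem act_const_mul (S : Matrix G G ℝ) (c : ℂ) (f : G → ℂ) (x : G) :
    act S (fun y => c * f y) x = c * act S f x := by
  simp [act, Finset.mul_sum, mul_left_comm]

theorem act_zero (S : Matrix G G ℝ) (x : G) : act S (fun _ => 0) x = 0 := by
  simp [act]

theorem act_sum {ι : Type*} (S : Matrix G G ℝ) (s : Finset ι) (f : ι → G → ℂ) (x : G) :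
    act S (fun y => ∑ i ∈ s, f i y) x = ∑ i ∈ s, act S (f i) x := by
  simp only [act, Finset.mul_sum]
  rw [Finset.sum_comm]

end Action

/-! ### Fourier analysis on a finite abelian group -/

section Fourier

variable {G : Type*} [AddCommGroup G] [Fintype G]

/-- The Fourier transform on a finite abelian group. -/
def ft (f : G → ℂ) (χ : AddChar G ℂ) : ℂ := ∑ x, f x * χ (-x)

/-- The inverse Fourier transform on a finite abelian group. -/
def invFt (c : AddChar G ℂ → ℂ) (x : G) : ℂ := (Fintype.card G : ℂ)⁻¹ * ∑ χ, c χ * χ x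

theorem card_group_ne_zero : (Fintype.card G : ℂ) ≠ 0 := by
  simp [Fintype.card_ne_zero]

theorem invFt_ft (f : G → ℂ) (x : G) : invFt (ft f) x = f x := by
  classical
  have h : ∑ χ : AddChar G ℂ, ft f χ * χ x = Fintype.card G * f x := by
    simp only [ft, Finset.sum_mul]
    rw [Finset.sum_comm]
    have : ∀ y, ∑ χ : AddChar G ℂ, f y * χ (-y) * χ x
        = if y = x then (Fintype.card G : ℂ) * f x else 0 := by
      intro y
      have h1 : ∑ χ : AddChar G ℂ, f y * χ (-y) * χ x = f y * ∑ χ : AddChar G ℂ, χ (x - y) := by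
        rw [Finset.mul_sum]
        refine Finset.sum_congr rfl fun χ _ => ?_
        rw [sub_eq_neg_add, AddChar.map_add_eq_mul, mul_assoc]
      rw [h1, AddChar.sum_apply_eq_ite]
      by_cases hy : y = x
      · subst hy; simp [mul_comm]
      · rw [if_neg (sub_ne_zero.2 (Ne.symm hy)), if_neg hy, mul_zero]
    rw [Finset.sum_congr rfl fun y _ => this y]
    simp
  rw [invFt, h, inv_mul_cancel_left₀ card_group_ne_zero]

theorem ft_invFt (c : AddChar G ℂ → ℂ) (χ : AddChar G ℂ) : ft (invFt c) χ = c χ := by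
  classical
  have h : ft (invFt c) χ
      = (Fintype.card G : ℂ)⁻¹ * ∑ ψ : AddChar G ℂ, c ψ * ∑ x, (ψ - χ) x := by
    simp only [ft, invFt, Finset.mul_sum, Finset.sum_mul]
    rw [Finset.sum_comm]
    refine Finset.sum_congr rfl fun ψ _ => Finset.sum_congr rfl fun x _ => ?_
    rw [AddChar.sub_apply]; ring
  rw [h]
  have : ∀ ψ : AddChar G ℂ, c ψ * ∑ x, (ψ - χ) x = if ψ = χ then Fintype.card G * c χ else 0 := by
    intro ψ
    rw [AddChar.sum_eq_ite]
    by_cases hy : ψ = χ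
    · subst hy; simp [mul_comm]
    · rw [if_neg (sub_ne_zero.2 hy), if_neg hy, mul_zero]
  rw [Finset.sum_congr rfl fun ψ _ => this ψ]
  simp

theorem ft_injective {f g : G → ℂ} (h : ∀ χ, ft f χ = ft g χ) : f = g := by
  funext x
  rw [← invFt_ft f x, ← invFt_ft g x, funext h]

theorem ft_add (f g : G → ℂ) (χ : AddChar G ℂ) :
    ft (fun x => f x + g x) χ = ft f χ + ft g χ := by
  simp [ft, add_mul, Finset.sum_add_distrib]

theorem ft_sub (f g : G → ℂ) (χ : AddChar G ℂ) :
    ft (fun x => f x - g x) χ = ft f χ - ft g χ := by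
  simp [ft, sub_mul, Finset.sum_sub_distrib]

theorem ft_const_mul (c : ℂ) (f : G → ℂ) (χ : AddChar G ℂ) :
    ft (fun x => c * f x) χ = c * ft f χ := by
  simp [ft, mul_assoc, Finset.mul_sum]

theorem ft_sum {ι : Type*} (s : Finset ι) (f : ι → G → ℂ) (χ : AddChar G ℂ) :
    ft (fun x => ∑ i ∈ s, f i x) χ = ∑ i ∈ s, ft (f i) χ := by
  simp only [ft, Finset.sum_mul]
  rw [Finset.sum_comm]

theorem norm_ft_dirac_le [DecidableEq G] (a : G) (g : G → ℂ) (χ : AddChar G ℂ) :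
    ‖ft (fun x => if a = x then g x else 0) χ‖ ≤ ‖g a‖ := by
  simp [ft, ite_mul]

theorem ft_mul (f g : G → ℂ) (χ : AddChar G ℂ) :
    ft (fun x => f x * g x) χ
      = (Fintype.card G : ℂ)⁻¹ * ∑ ψ : AddChar G ℂ, ft f ψ * ft g (χ - ψ) := by
  have h : ft (fun x => f x * g x) χ = ft (fun x => invFt (ft f) x * g x) χ := by
    simp only [invFt_ft]
  rw [h]
  conv_lhs => rw [ft]
  conv_rhs => simp only [ft.eq_1 g]
  simp only [invFt, Finset.mul_sum, Finset.sum_mul]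
  rw [Finset.sum_comm]
  refine Finset.sum_congr rfl fun ψ _ => Finset.sum_congr rfl fun x _ => ?_
  rw [AddChar.sub_apply, neg_neg]; ring

/-- The normalised `ℓ¹` norm of the Fourier transform. -/
def wienerNorm (f : G → ℂ) : ℝ := (Fintype.card G : ℝ)⁻¹ * ∑ χ, ‖ft f χ‖

theorem norm_le_wienerNorm (f : G → ℂ) (x : G) : ‖f x‖ ≤ wienerNorm f := by
  conv_lhs => rw [← invFt_ft f x]
  rw [invFt, norm_mul, norm_inv, Complex.norm_natCast, wienerNorm]
  gcongr
  refine (norm_sum_le _ _).trans (Finset.sum_le_sum fun χ _ => ?_)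
  simp

theorem norm_ft_mul_le (f g : G → ℂ) (χ : AddChar G ℂ) :
    ‖ft (fun x => f x * g x) χ‖
      ≤ (Fintype.card G : ℝ)⁻¹ * ∑ ψ : AddChar G ℂ, ‖ft f ψ‖ * ‖ft g (χ - ψ)‖ := by
  rw [ft_mul, norm_mul, norm_inv, Complex.norm_natCast]
  gcongr
  refine (norm_sum_le _ _).trans (Finset.sum_le_sum fun ψ _ => ?_)
  rw [norm_mul]

theorem sum_norm_ft_sub (g : G → ℂ) (χ : AddChar G ℂ) :
    ∑ ψ : AddChar G ℂ, ‖ft g (χ - ψ)‖ = ∑ ψ : AddChar G ℂ, ‖ft g ψ‖ :=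
  Equiv.sum_comp (Equiv.subLeft χ) fun ψ => ‖ft g ψ‖

/-- Young's inequality `ℓ^∞ * ℓ¹ → ℓ^∞` for the convolution on the dual group. -/
theorem norm_ft_mul_le_of_left {f g : G → ℂ} {A : ℝ} (hf : ∀ χ, ‖ft f χ‖ ≤ A)
    (χ : AddChar G ℂ) : ‖ft (fun x => f x * g x) χ‖ ≤ A * wienerNorm g := by
  refine (norm_ft_mul_le f g χ).trans ?_
  have h : A * wienerNorm g
      = (Fintype.card G : ℝ)⁻¹ * ∑ ψ : AddChar G ℂ, A * ‖ft g (χ - ψ)‖ := by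
    rw [← Finset.mul_sum, sum_norm_ft_sub, wienerNorm]; ring
  rw [h]
  gcongr with ψ
  exact hf ψ

theorem norm_ft_mul_le_of_right {f g : G → ℂ} {A : ℝ} (hg : ∀ χ, ‖ft g χ‖ ≤ A)
    (χ : AddChar G ℂ) : ‖ft (fun x => f x * g x) χ‖ ≤ wienerNorm f * A := by
  have := norm_ft_mul_le_of_left (f := g) (g := f) hg χ
  simpa only [mul_comm] using this

/-- `S` is the convolution operator with the real Fourier multiplier `s`, a stochastic kernel whose
spectrum is contained in `[-1 + c, 1]`, and `1 - s` is subadditive up to a factor `2`. -/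
structure IsSymbol (S : Matrix G G ℝ) (s : AddChar G ℂ → ℝ) (c : ℝ) : Prop where
  ft_act : ∀ f χ, ft (act S f) χ = s χ * ft f χ
  act_const : ∀ (a : ℂ) (x : G), act S (fun _ => a) x = a
  le_one : ∀ χ, s χ ≤ 1
  lower : ∀ χ, -1 + c ≤ s χ
  pos : 0 < c
  subadd : ∀ χ ψ, 1 - s (χ + ψ) ≤ 2 * (1 - s χ) + 2 * (1 - s ψ)

/-- The solution operator `(1 - ζ S)⁻¹`. -/
def resolventAct (s : AddChar G ℂ → ℝ) (ζ : ℂ) (f : G → ℂ) (x : G) : ℂ :=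
  invFt (fun χ => (1 - ζ * s χ)⁻¹ * ft f χ) x

variable {S : Matrix G G ℝ} {s : AddChar G ℂ → ℝ} {c : ℝ}

theorem IsSymbol.abs_le_one (h : IsSymbol S s c) (χ : AddChar G ℂ) : |s χ| ≤ 1 := by
  have := h.le_one χ; have := h.lower χ; have := h.pos
  rw [abs_le]; constructor <;> linarith

theorem IsSymbol.one_sub_ne_zero (h : IsSymbol S s c) {ζ : ℂ} (hζ : ‖ζ‖ < 1) (χ : AddChar G ℂ) :
    1 - ζ * s χ ≠ 0 := by
  intro h0
  have h1 : ζ * s χ = 1 := (sub_eq_zero.1 h0).symm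
  have h2 : ‖ζ‖ * |s χ| = 1 := by
    rw [← Real.norm_eq_abs, ← Complex.norm_real, ← norm_mul, h1, norm_one]
  have := h.abs_le_one χ
  nlinarith [norm_nonneg ζ, abs_nonneg (s χ)]

theorem IsSymbol.ft_sub_act (h : IsSymbol S s c) (ζ : ℂ) (f : G → ℂ) (χ : AddChar G ℂ) :
    ft (fun x => f x - ζ * act S f x) χ = (1 - ζ * s χ) * ft f χ := by
  rw [ft_sub, ft_const_mul, h.ft_act]; ring

theorem IsSymbol.resolventAct_sub (h : IsSymbol S s c) {ζ : ℂ} (hζ : ‖ζ‖ < 1) (f : G → ℂ) (x : G) :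
    resolventAct s ζ f x - ζ * act S (resolventAct s ζ f) x = f x := by
  have : (fun x => resolventAct s ζ f x - ζ * act S (resolventAct s ζ f) x) = f := by
    refine ft_injective fun χ => ?_
    rw [h.ft_sub_act]
    unfold resolventAct
    rw [ft_invFt, mul_inv_cancel_left₀ (h.one_sub_ne_zero hζ χ)]
  exact congrFun this x

/-- The uniqueness that later identifies two solutions of the same linear recursion. -/
theorem IsSymbol.eq_zero_of_sub_act (h : IsSymbol S s c) {ζ : ℂ} (hζ : ‖ζ‖ < 1) {f : G → ℂ}
    (hf : ∀ x, f x - ζ * act S f x = 0) (x : G) : f x = 0 := by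
  have : f = fun _ => 0 := by
    refine ft_injective fun χ => ?_
    have h1 := h.ft_sub_act ζ f χ
    simp only [hf] at h1
    have h2 : ft (fun _ : G => (0 : ℂ)) χ = 0 := by simp [ft]
    rw [h2] at h1 ⊢
    exact (mul_eq_zero.1 h1.symm).resolve_left (h.one_sub_ne_zero hζ χ)
  rw [this]

end Fourier

/-! ### Letters of a word by position -/

section Words

variable {G : Type*} [AddCommGroup G]

/-- The charge at position `j` of a word. -/
def chargeAt (w : List (Bool × G)) (j : ℕ) : Bool := (w.getD j (true, 0)).1

/-- The site at position `j` of a word. -/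
def siteAt (w : List (Bool × G)) (j : ℕ) : G := (w.getD j (true, 0)).2

theorem drop_take_eq_cons (w : List (Bool × G)) {i j : ℕ} (hij : i < j) (hj : j < w.length) :
    (w.take j).drop i = (chargeAt w i, siteAt w i) :: (w.take j).drop (i + 1) := by
  rw [List.drop_eq_getElem_cons (by simp; omega)]
  simp [chargeAt, siteAt, List.getElem?_eq_getElem (show i < w.length by omega)]

end Words

/-! ### Recursive construction of the chains -/

section Chain

variable {G : Type*} [AddCommGroup G] [Fintype G] [DecidableEq G]

/-- The primitive loop with index `p ++ [(σ, x)]`, normalised to `W = 1`, as a function of the last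
site `x`. -/
def chain (S : Matrix G G ℝ) (s : AddChar G ℂ → ℝ) (μ : Bool → ℂ) (t : ℝ) :
    List (Bool × G) → Bool → G → ℂ
  | [], σ => fun _ => μ σ
  -- The sum stops before the last vertex: the term at the last vertex is `t μ(σ₀) μ(σ)` times `S`
  -- applied to the chain itself, and the resolvent accounts for it.
  | (σ₀, a₀) :: q, σ => resolventAct s (t * μ σ₀ * μ σ) fun y =>
      μ σ₀ * ((if a₀ = y then chain S s μ t q σ y else 0) +
        t * ∑ p : Fin q.length,
          act S (chain S s μ t ((σ₀, a₀) :: q.take p) (q.get p).1) y *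
            chain S s μ t (q.drop p) σ y)
termination_by p => p.length
decreasing_by all_goals (simp; try omega)

/-- The chain between the positions `i` and `j` of a word; zero if `j < i`. -/
def subchain (S : Matrix G G ℝ) (s : AddChar G ℂ → ℝ) (μ : Bool → ℂ) (t : ℝ)
    (w : List (Bool × G)) (i j : ℕ) (x : G) : ℂ :=
  if i ≤ j then chain S s μ t ((w.take j).drop i) (chargeAt w j) x else 0

variable {S : Matrix G G ℝ} {s : AddChar G ℂ → ℝ} {c : ℝ} {μ : Bool → ℂ} {t : ℝ}

theorem chain_nil (σ : Bool) (x : G) : chain S s μ t [] σ x = μ σ := by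
  rw [chain]

/-- Undoing the resolvent puts the term at the last vertex back, so the recursion becomes a
fixed-point equation. -/
theorem IsSymbol.chain_cons (h : IsSymbol S s c) (hμ : ∀ σ, ‖μ σ‖ = 1) (ht : |t| < 1)
    (σ₀ : Bool) (a₀ : G) (q : List (Bool × G)) (σ : Bool) (x : G) :
    chain S s μ t ((σ₀, a₀) :: q) σ x
      = μ σ₀ * ((if a₀ = x then chain S s μ t q σ x else 0) +
        t * (∑ p : Fin q.length,
          act S (chain S s μ t ((σ₀, a₀) :: q.take p) (q.get p).1) x *
            chain S s μ t (q.drop p) σ x +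
          act S (chain S s μ t ((σ₀, a₀) :: q) σ) x * μ σ)) := by
  have hζ : ‖(t * μ σ₀ * μ σ : ℂ)‖ < 1 := by
    rw [norm_mul, norm_mul, hμ, hμ, Complex.norm_real]; simpa using ht
  have key := h.resolventAct_sub hζ (fun y =>
      μ σ₀ * ((if a₀ = y then chain S s μ t q σ y else 0) +
        t * ∑ p : Fin q.length,
          act S (chain S s μ t ((σ₀, a₀) :: q.take p) (q.get p).1) y *
            chain S s μ t (q.drop p) σ y)) x
  have hc : chain S s μ t ((σ₀, a₀) :: q) σ = resolventAct s (t * μ σ₀ * μ σ) (fun y =>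
      μ σ₀ * ((if a₀ = y then chain S s μ t q σ y else 0) +
        t * ∑ p : Fin q.length,
          act S (chain S s μ t ((σ₀, a₀) :: q.take p) (q.get p).1) y *
            chain S s μ t (q.drop p) σ y)) := by
    rw [chain]
  rw [← hc] at key
  linear_combination key

theorem subchain_self (w : List (Bool × G)) (j : ℕ) (x : G) :
    subchain S s μ t w j j x = μ (chargeAt w j) := by
  rw [subchain, if_pos le_rfl, List.drop_eq_nil_of_le (by simp), chain_nil]

theorem subchain_of_lt (w : List (Bool × G)) {i j : ℕ} (h : j < i) (x : G) :
    subchain S s μ t w i j x = 0 := by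
  rw [subchain, if_neg (by omega)]

theorem subchain_of_lt' (w : List (Bool × G)) {i j : ℕ} (h : j < i) :
    subchain S s μ t w i j = fun _ => 0 := by
  funext x; exact subchain_of_lt w h x

/-- The recursion in terms of positions of one fixed word. All chains involved are then entries of a
single upper triangular matrix indexed by positions. -/
theorem IsSymbol.subchain_eq (h : IsSymbol S s c) (hμ : ∀ σ, ‖μ σ‖ = 1) (ht : |t| < 1)
    (w : List (Bool × G)) {i j : ℕ} (hij : i < j) (hj : j < w.length) (x : G) :
    subchain S s μ t w i j x
      = μ (chargeAt w i) * ((if siteAt w i = x then subchain S s μ t w (i + 1) j x else 0) +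
        t * ∑ p ∈ Finset.Ioc i j,
          act S (subchain S s μ t w i p) x * subchain S s μ t w p j x) := by
  have e0 : subchain S s μ t w i j = chain S s μ t ((w.take j).drop i) (chargeAt w j) := by
    funext y; rw [subchain, if_pos hij.le]
  have e1 : subchain S s μ t w (i + 1) j x
      = chain S s μ t ((w.take j).drop (i + 1)) (chargeAt w j) x := by
    rw [subchain, if_pos (show i + 1 ≤ j from hij)]
  have hl : ((w.take j).drop (i + 1)).length = j - (i + 1) := by simp; omega
  have hsum : ∑ p ∈ Finset.Ioc i j, act S (subchain S s μ t w i p) x * subchain S s μ t w p j x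
      = ∑ p : Fin ((w.take j).drop (i + 1)).length,
          act S (chain S s μ t ((chargeAt w i, siteAt w i) :: ((w.take j).drop (i + 1)).take p)
            (((w.take j).drop (i + 1)).get p).1) x *
            chain S s μ t (((w.take j).drop (i + 1)).drop p) (chargeAt w j) x +
        act S (chain S s μ t ((w.take j).drop i) (chargeAt w j)) x * μ (chargeAt w j) := by
    have hI : Finset.Ioc i j = Finset.Ico (i + 1) (j + 1) := by ext; simp
    rw [hI, Finset.sum_Ico_succ_top (by omega), subchain_self, e0]
    congr 1
    rw [Finset.sum_Ico_eq_sum_range, ← hl, ← Fin.sum_univ_eq_sum_range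
      (fun p => act S (subchain S s μ t w i (i + 1 + p)) x * subchain S s μ t w (i + 1 + p) j x)]
    refine Finset.sum_congr rfl fun p _ => ?_
    have hp : (p : ℕ) < j - (i + 1) := hl ▸ p.2
    have e2 : subchain S s μ t w i (i + 1 + p)
        = chain S s μ t ((chargeAt w i, siteAt w i) :: ((w.take j).drop (i + 1)).take p)
            (((w.take j).drop (i + 1)).get p).1 := by
      funext y
      rw [subchain, if_pos (by omega), drop_take_eq_cons w (by omega) (by omega)]
      congr 2
      · rw [List.take_drop, List.take_take, min_eq_left (by omega)]
      · simp [chargeAt, List.getElem?_eq_getElem (show i + 1 + (p : ℕ) < w.length by omega)]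
    have e3 : subchain S s μ t w (i + 1 + p) j x
        = chain S s μ t (((w.take j).drop (i + 1)).drop p) (chargeAt w j) x := by
      rw [subchain, if_pos (by omega), List.drop_drop]
    rw [e2, e3]
  rw [hsum, e1, e0, drop_take_eq_cons w hij hj]
  exact h.chain_cons hμ ht _ _ _ _ x

end Chain

/-! ### The mirrored recursion and the Ward identity -/

section Mirror

variable {G : Type*} [AddCommGroup G] [Fintype G] [DecidableEq G]
variable {S : Matrix G G ℝ} {s : AddChar G ℂ → ℝ} {c : ℝ} {μ : Bool → ℂ} {t : ℝ}

theorem IsSymbol.act_subchain_self (h : IsSymbol S s c) (w : List (Bool × G)) (j : ℕ) (x : G) :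
    act S (subchain S s μ t w j j) x = μ (chargeAt w j) := by
  have : subchain S s μ t w j j = fun _ => μ (chargeAt w j) := by
    funext y; exact subchain_self w j y
  rw [this, h.act_const]

/-- Triangularity kills `k < i` and `k > j`, and `k = i` contributes `μ_i M_ij` since `S` fixes
constants. This translates the matrix product into the sum of the recursion. -/
theorem IsSymbol.sum_act_subchain_mul (h : IsSymbol S s c) (w : List (Bool × G)) {i j n : ℕ}
    (hi : i < n) (hj : j < n) (x : G) :
    ∑ k ∈ Finset.range n, act S (subchain S s μ t w i k) x * subchain S s μ t w k j x
      = μ (chargeAt w i) * subchain S s μ t w i j x + ∑ k ∈ Finset.Ioc i j,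
          act S (subchain S s μ t w i k) x * subchain S s μ t w k j x := by
  rw [← h.act_subchain_self (μ := μ) (t := t) w i x, ← Finset.sum_insert (by simp)
    (f := fun k => act S (subchain S s μ t w i k) x * subchain S s μ t w k j x)]
  symm
  refine Finset.sum_subset ?_ ?_
  · intro k; simp; omega
  · intro k hk hk'
    simp only [Finset.mem_insert, Finset.mem_Ioc, Finset.mem_range] at hk hk'
    rcases lt_or_ge k i with hki | hki
    · rw [subchain_of_lt' w hki, act_zero, zero_mul]
    · rw [subchain_of_lt w (by omega), mul_zero]

/-- The inverse of the matrix of subchains at the site `x`. -/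
def loopMatrix (S : Matrix G G ℝ) (s : AddChar G ℂ → ℝ) (μ : Bool → ℂ) (t : ℝ)
    (w : List (Bool × G)) (n : ℕ) (x : G) : Matrix (Fin n) (Fin n) ℂ :=
  -- On the diagonal `S M_ii = μ_i`, so the added `t μ_i` cancels and the entry is `μ_i⁻¹`, as it
  -- must be for an inverse of a triangular matrix with diagonal `μ_i`.
  Matrix.of fun i j => (if i = j then (μ (chargeAt w i))⁻¹ + t * μ (chargeAt w i) else 0)
    - t * act S (subchain S s μ t w i j) x
    - (if (j : ℕ) = i + 1 ∧ siteAt w i = x then 1 else 0)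

/-- Off the diagonal, entry `(i, j)` with `i < j` is the recursion divided by `μ_i`; below the
diagonal everything vanishes. -/
theorem IsSymbol.loopMatrix_mul (h : IsSymbol S s c) (hμ : ∀ σ, ‖μ σ‖ = 1) (ht : |t| < 1)
    (w : List (Bool × G)) (x : G) :
    loopMatrix S s μ t w w.length x
      * Matrix.of (fun i j : Fin w.length => subchain S s μ t w i j x) = 1 := by
  have hne : ∀ σ, μ σ ≠ 0 := fun σ h0 => by simpa [h0] using hμ σ
  ext i j
  have h1 : ∑ k : Fin w.length, act S (subchain S s μ t w i k) x * subchain S s μ t w k j x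
      = μ (chargeAt w i) * subchain S s μ t w i j x + ∑ k ∈ Finset.Ioc (i : ℕ) j,
          act S (subchain S s μ t w i k) x * subchain S s μ t w k j x := by
    rw [Fin.sum_univ_eq_sum_range
      (fun k => act S (subchain S s μ t w i k) x * subchain S s μ t w k j x)]
    exact h.sum_act_subchain_mul w i.2 j.2 x
  have h2 : ∑ k : Fin w.length,
      (if (k : ℕ) = i + 1 ∧ siteAt w i = x then 1 else 0) * subchain S s μ t w k j x
      = if siteAt w i = x then subchain S s μ t w (i + 1) j x else 0 := by
    rw [Fin.sum_univ_eq_sum_range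
      (fun k => (if k = i + 1 ∧ siteAt w i = x then 1 else 0) * subchain S s μ t w k j x)]
    by_cases hs : siteAt w i = x
    · simp only [hs, and_true, if_true, ite_mul, one_mul, zero_mul, Finset.sum_ite_eq',
        Finset.mem_range]
      split_ifs with hi
      · rfl
      -- In the last row there is no index `i + 1`, but then `j ≤ i` and the right-hand side is zero
      -- as well.
      · rw [subchain_of_lt w (by omega)]
    · simp [hs]
  have h3 : (loopMatrix S s μ t w w.length x
      * Matrix.of (fun i j : Fin w.length => subchain S s μ t w i j x)) i j
      = ((μ (chargeAt w i))⁻¹ + t * μ (chargeAt w i)) * subchain S s μ t w i j x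
        - t * (∑ k : Fin w.length, act S (subchain S s μ t w i k) x * subchain S s μ t w k j x)
        - ∑ k : Fin w.length,
      (if (k : ℕ) = i + 1 ∧ siteAt w i = x then 1 else 0) * subchain S s μ t w k j x := by
    simp only [loopMatrix, Matrix.mul_apply, Matrix.of_apply, sub_mul, Finset.sum_sub_distrib,
      ite_mul, zero_mul, Finset.sum_ite_eq, Finset.mem_univ, if_true, Finset.mul_sum, mul_assoc]
  rw [h3, h1, h2]
  have hi := hne (chargeAt w i)
  rcases lt_trichotomy (i : ℕ) j with hij | hij | hij
  · have key := h.subchain_eq hμ ht w hij j.2 x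
    rw [Matrix.one_apply_ne (by intro e; simp [e] at hij)]
    have key' := congrArg (fun z => (μ (chargeAt w i))⁻¹ * z) key
    simp only [inv_mul_cancel_left₀ hi] at key'
    linear_combination key'
  · obtain rfl : i = j := Fin.ext hij
    rw [Matrix.one_apply_eq, subchain_of_lt w (Nat.lt_succ_self _), subchain_self]
    simp only [Finset.Ioc_self, Finset.sum_empty, ite_self]
    field_simp
    ring
  · rw [Matrix.one_apply_ne (by intro e; simp [e] at hij), subchain_of_lt w hij,
      subchain_of_lt w (by omega), Finset.Ioc_eq_empty (by omega)]
    simp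

/-- The entry `(0, L)` of the product in the opposite order. Here `S` acts on the right factor and
the cuts run from the last vertex, which would be hard to read off the recursive definition. -/
theorem IsSymbol.subchain_eq_mirror (h : IsSymbol S s c) (hμ : ∀ σ, ‖μ σ‖ = 1) (ht : |t| < 1)
    (w : List (Bool × G)) {L : ℕ} (hL : 1 ≤ L) (hw : w.length = L + 1) (x : G) :
    subchain S s μ t w 0 L x
      = μ (chargeAt w L) * ((if siteAt w (L - 1) = x then subchain S s μ t w 0 (L - 1) x else 0) +
        t * ∑ p ∈ Finset.Ico 0 L,
          subchain S s μ t w 0 p x * act S (subchain S s μ t w p L) x) := by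
  have hne : ∀ σ, μ σ ≠ 0 := fun σ h0 => by simpa [h0] using hμ σ
  have h0 := mul_eq_one_comm.1 (h.loopMatrix_mul hμ ht w x)
  have h1 := congrFun (congrFun h0 ⟨0, by omega⟩) ⟨L, by omega⟩
  rw [Matrix.one_apply_ne (by intro e; simp at e; omega)] at h1
  have h3 : ∑ k : Fin w.length, subchain S s μ t w 0 k x * act S (subchain S s μ t w k L) x
      = ∑ p ∈ Finset.Ico 0 L, subchain S s μ t w 0 p x * act S (subchain S s μ t w p L) x
        + subchain S s μ t w 0 L x * μ (chargeAt w L) := by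
    rw [Fin.sum_univ_eq_sum_range
      (fun k => subchain S s μ t w 0 k x * act S (subchain S s μ t w k L) x), hw,
      Finset.sum_range_succ, h.act_subchain_self, Finset.range_eq_Ico]
  have h2 : ∑ k : Fin w.length,
      subchain S s μ t w 0 k x * (if L = (k : ℕ) + 1 ∧ siteAt w k = x then 1 else 0)
      = if siteAt w (L - 1) = x then subchain S s μ t w 0 (L - 1) x else 0 := by
    rw [Fin.sum_univ_eq_sum_range
      (fun k => subchain S s μ t w 0 k x * (if L = k + 1 ∧ siteAt w k = x then 1 else 0)),
      Finset.sum_eq_single (L - 1)]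
    · rw [Nat.sub_add_cancel hL]; simp
    · intro k _ hk
      rw [if_neg (by omega), mul_zero]
    · intro hk; simp at hk; omega
  have h4 : ∑ k : Fin w.length, subchain S s μ t w 0 k x *
      (if k = (⟨L, by omega⟩ : Fin w.length) then
        (μ (chargeAt w k))⁻¹ + t * μ (chargeAt w k) else 0)
      = subchain S s μ t w 0 L x * ((μ (chargeAt w L))⁻¹ + t * μ (chargeAt w L)) := by
    simp
  simp only [loopMatrix, Matrix.mul_apply, Matrix.of_apply, mul_sub, Finset.sum_sub_distrib] at h1
  rw [h4, h2] at h1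
  have h5 : ∑ k : Fin w.length,
      subchain S s μ t w 0 k x * (t * act S (subchain S s μ t w k L) x)
      = t * (∑ p ∈ Finset.Ico 0 L, subchain S s μ t w 0 p x * act S (subchain S s μ t w p L) x
        + subchain S s μ t w 0 L x * μ (chargeAt w L)) := by
    rw [← h3, Finset.mul_sum]
    exact Finset.sum_congr rfl fun k _ => by ring
  rw [h5] at h1
  have hi := hne (chargeAt w L)
  field_simp at h1
  linear_combination h1

/-- The local Ward identity. -/
theorem IsSymbol.ward (h : IsSymbol S s c) (hμ : ∀ σ, ‖μ σ‖ = 1) (ht : |t| < 1)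
    (w : List (Bool × G)) {L : ℕ} (hL : 1 ≤ L) (hw : w.length = L + 1)
    (h1 : μ (chargeAt w 0) * μ (chargeAt w L) = 1) (x : G) :
    (μ (chargeAt w L) - μ (chargeAt w 0)) *
        (subchain S s μ t w 0 L x - t * act S (subchain S s μ t w 0 L) x)
      = (if siteAt w 0 = x then subchain S s μ t w 1 L x else 0)
        - (if siteAt w (L - 1) = x then subchain S s μ t w 0 (L - 1) x else 0)
        + ∑ p ∈ Finset.Ico 1 L,
          (subchain S s μ t w 0 p x *
              (subchain S s μ t w p L x - t * act S (subchain S s μ t w p L) x)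
            - (subchain S s μ t w 0 p x - t * act S (subchain S s μ t w 0 p) x) *
              subchain S s μ t w p L x) := by
  have r1 := h.subchain_eq hμ ht w (i := 0) (j := L) (by omega) (by omega) x
  have r2 := h.subchain_eq_mirror hμ ht w hL hw x
  have hI : Finset.Ioc 0 L = Finset.Ico 1 (L + 1) := by ext; simp; omega
  rw [hI, Finset.sum_Ico_succ_top hL, subchain_self, zero_add] at r1
  rw [Finset.sum_eq_sum_Ico_succ_bot (by omega : 0 < L), subchain_self, zero_add] at r2
  -- The products `M_0p M_pL` cancel; they are inserted so that every product contains a factor `(1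
  -- - t S) M`.
  have hs : ∑ p ∈ Finset.Ico 1 L,
          (subchain S s μ t w 0 p x *
              (subchain S s μ t w p L x - t * act S (subchain S s μ t w p L) x)
            - (subchain S s μ t w 0 p x - t * act S (subchain S s μ t w 0 p) x) *
              subchain S s μ t w p L x)
      = t * ∑ p ∈ Finset.Ico 1 L,
          act S (subchain S s μ t w 0 p) x * subchain S s μ t w p L x
        - t * ∑ p ∈ Finset.Ico 1 L,
          subchain S s μ t w 0 p x * act S (subchain S s μ t w p L) x := by
    rw [← mul_sub, ← Finset.sum_sub_distrib, Finset.mul_sum]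
    exact Finset.sum_congr rfl fun p _ => by ring
  rw [hs]
  set A := ∑ p ∈ Finset.Ico 1 L, act S (subchain S s μ t w 0 p) x * subchain S s μ t w p L x
  set B := ∑ p ∈ Finset.Ico 1 L, subchain S s μ t w 0 p x * act S (subchain S s μ t w p L) x
  set P := subchain S s μ t w 0 L x
  set Q := act S (subchain S s μ t w 0 L) x
  set D₁ := if siteAt w 0 = x then subchain S s μ t w 1 L x else 0
  set D₂ := if siteAt w (L - 1) = x then subchain S s μ t w 0 (L - 1) x else 0
  set u := μ (chargeAt w 0)
  set v := μ (chargeAt w L)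
  -- The recursion times `μ_L` minus its mirror image times `μ_0`, simplified with `μ_0 μ_L = 1`.
  linear_combination v * r1 - u * r2 + (D₁ + t * A - D₂ - t * B - t * v * Q + t * u * Q +
    2 * t * Q * v - 2 * t * Q * u) * h1
end Mirror

/-! ### Differentiation in time of kernels and resolvents -/

section ActDerivative

variable {G : Type*} [Fintype G] {S : Matrix G G ℝ} {t : ℝ}

theorem differentiableAt_act {f : ℝ → G → ℂ} (hf : ∀ y, DifferentiableAt ℝ (fun u => f u y) t)
    (x : G) : DifferentiableAt ℝ (fun u => act S (f u) x) t := by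
  unfold act
  exact DifferentiableAt.fun_sum fun y _ => (hf y).const_mul _

theorem hasDerivAt_act {f : ℝ → G → ℂ} {f' : G → ℂ}
    (hf : ∀ y, HasDerivAt (fun u => f u y) (f' y) t)
    (x : G) : HasDerivAt (fun u => act S (f u) x) (act S f' x) t := by
  unfold act
  exact HasDerivAt.fun_sum fun y _ => (hf y).const_mul _

end ActDerivative

section ResolventDerivative

variable {G : Type*} [AddCommGroup G] [Fintype G] {s : AddChar G ℂ → ℝ} {t : ℝ}

theorem differentiableAt_resolventAct {ζ : ℝ → ℂ} {f : ℝ → G → ℂ}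
    (h0 : ∀ χ, 1 - ζ t * s χ ≠ 0) (hζ : DifferentiableAt ℝ ζ t)
    (hf : ∀ y, DifferentiableAt ℝ (fun u => f u y) t) (x : G) :
    DifferentiableAt ℝ (fun u => resolventAct s (ζ u) (f u) x) t := by
  unfold resolventAct invFt ft
  refine DifferentiableAt.const_mul (DifferentiableAt.fun_sum fun χ _ => ?_) _
  refine DifferentiableAt.mul_const (DifferentiableAt.mul ?_ ?_) _
  · exact DifferentiableAt.inv ((hζ.mul_const _).const_sub _) (h0 χ)
  · exact DifferentiableAt.fun_sum fun y _ => (hf y).mul_const _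

end ResolventDerivative

/-! ### Letters of a cut word -/

section CutWord

variable {G : Type*} [AddCommGroup G]

/-- The left cut of a word at the positions `k < l`. -/
def cutWord (w : List (Bool × G)) (k l : ℕ) (a : G) : List (Bool × G) :=
  w.take k ++ (chargeAt w k, a) :: w.drop l

theorem cutWord_getElem?_lt {w : List (Bool × G)} {k l : ℕ} (a : G) (hk : k < w.length) {p : ℕ}
    (hp : p < k) : (cutWord w k l a)[p]? = w[p]? := by
  rw [cutWord, List.getElem?_append_left (by simp; omega), List.getElem?_take_of_lt hp]

theorem cutWord_getElem?_eq {w : List (Bool × G)} {k l : ℕ} (a : G) (hk : k < w.length) :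
    (cutWord w k l a)[k]? = some (chargeAt w k, a) := by
  rw [cutWord, List.getElem?_append_right (by simp)]
  simp [min_eq_left hk.le]

/-- The letters `k, …, l - 1` are replaced by one letter at `k`, so the old position `l` becomes `k
+ 1`. -/
theorem cutWord_getElem?_gt {w : List (Bool × G)} {k l : ℕ} (a : G) (hk : k < w.length) {q : ℕ}
    (hq : l ≤ q) : (cutWord w k l a)[q + (k + 1) - l]? = w[q]? := by
  rw [cutWord, List.getElem?_append_right (by simp; omega), List.length_take, min_eq_left hk.le,
    show q + (k + 1) - l - k = (q - l) + 1 by omega, List.getElem?_cons_succ, List.getElem?_drop]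
  congr 1; omega

theorem cutWord_length {w : List (Bool × G)} {k l : ℕ} (a : G) (hk : k < w.length) :
    (cutWord w k l a).length = w.length - l + (k + 1) := by
  simp [cutWord, min_eq_left hk.le]; omega

theorem chargeAt_cutWord_le {w : List (Bool × G)} {k l : ℕ} (a : G) (hk : k < w.length) {p : ℕ}
    (hp : p ≤ k) : chargeAt (cutWord w k l a) p = chargeAt w p := by
  rcases hp.lt_or_eq with hp | rfl
  · simp [chargeAt, cutWord_getElem?_lt a hk hp]
  · simp [chargeAt, cutWord_getElem?_eq a hk]

theorem siteAt_cutWord_lt {w : List (Bool × G)} {k l : ℕ} (a : G) (hk : k < w.length) {p : ℕ}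
    (hp : p < k) : siteAt (cutWord w k l a) p = siteAt w p := by
  simp [siteAt, cutWord_getElem?_lt a hk hp]

theorem siteAt_cutWord_eq {w : List (Bool × G)} {k l : ℕ} (a : G) (hk : k < w.length) :
    siteAt (cutWord w k l a) k = a := by
  simp [siteAt, cutWord_getElem?_eq a hk]

theorem chargeAt_cutWord_gt {w : List (Bool × G)} {k l : ℕ} (a : G) (hk : k < w.length) {q : ℕ}
    (hq : l ≤ q) : chargeAt (cutWord w k l a) (q + (k + 1) - l) = chargeAt w q := by
  simp [chargeAt, cutWord_getElem?_gt a hk hq]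

theorem siteAt_cutWord_gt {w : List (Bool × G)} {k l : ℕ} (a : G) (hk : k < w.length) {q : ℕ}
    (hq : l ≤ q) : siteAt (cutWord w k l a) (q + (k + 1) - l) = siteAt w q := by
  simp [siteAt, cutWord_getElem?_gt a hk hq]

end CutWord

/-! ### The chains solve the primitive equation -/

section Derivative

variable {G : Type*} [AddCommGroup G] [Fintype G] [DecidableEq G]
variable {S : Matrix G G ℝ} {s : AddChar G ℂ → ℝ} {c : ℝ} {μ : Bool → ℂ} {t : ℝ}

theorem IsSymbol.differentiableAt_chain (h : IsSymbol S s c) (hμ : ∀ σ, ‖μ σ‖ = 1) (ht : |t| < 1)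
    (p : List (Bool × G)) (σ : Bool) (x : G) :
    DifferentiableAt ℝ (fun u => chain S s μ u p σ x) t := by
  induction hn : p.length using Nat.strong_induction_on generalizing p σ x with
  | _ n ih =>
  have hid : DifferentiableAt ℝ (fun u : ℝ => (u : ℂ)) t :=
    (hasDerivAt_id t).ofReal_comp.differentiableAt
  match p, hn with
  | [], _ => simp only [chain_nil]; exact differentiableAt_const _
  | (σ₀, a₀) :: q, hn =>
    rw [List.length_cons] at hn
    have e : (fun u => chain S s μ u ((σ₀, a₀) :: q) σ x) = fun u : ℝ =>
        resolventAct s (u * μ σ₀ * μ σ) (fun y =>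
          μ σ₀ * ((if a₀ = y then chain S s μ u q σ y else 0) +
            u * ∑ p : Fin q.length,
              act S (chain S s μ u ((σ₀, a₀) :: q.take p) (q.get p).1) y *
              chain S s μ u (q.drop p) σ y)) x := by
      funext u; rw [chain]
    rw [e]
    refine differentiableAt_resolventAct (ζ := fun u : ℝ => (u * μ σ₀ * μ σ : ℂ)) ?_ ?_ ?_ x
    · intro χ
      refine h.one_sub_ne_zero ?_ χ
      rw [norm_mul, norm_mul, hμ, hμ, Complex.norm_real]; simpa using ht
    · exact (hid.mul_const _).mul_const _
    · intro y
      refine DifferentiableAt.const_mul (DifferentiableAt.add ?_ (hid.mul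
        (DifferentiableAt.fun_sum fun p _ => DifferentiableAt.mul ?_ ?_))) _
      · by_cases hy : a₀ = y
        · simp only [hy, if_true]; exact ih _ (by omega) _ _ _ rfl
        · simp only [hy, if_false]; exact differentiableAt_const _
      · exact differentiableAt_act (fun z => ih (p + 1) (by omega) _ _ _ (by simp)) y
      · exact ih _ (by have := p.2; omega) _ _ _ (List.length_drop ..)

theorem IsSymbol.differentiableAt_subchain (h : IsSymbol S s c) (hμ : ∀ σ, ‖μ σ‖ = 1)
    (ht : |t| < 1) (w : List (Bool × G)) (i j : ℕ) (x : G) :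
    DifferentiableAt ℝ (fun u => subchain S s μ u w i j x) t := by
  unfold subchain
  split_ifs
  · exact h.differentiableAt_chain hμ ht _ _ _
  · exact differentiableAt_const _

/-- The time derivative of a subchain. -/
def derivSubchain (S : Matrix G G ℝ) (s : AddChar G ℂ → ℝ) (μ : Bool → ℂ) (t : ℝ)
    (w : List (Bool × G)) (i j : ℕ) (x : G) : ℂ :=
  deriv (fun u => subchain S s μ u w i j x) t

theorem derivSubchain_self (w : List (Bool × G)) (j : ℕ) (x : G) :
    derivSubchain S s μ t w j j x = 0 := by
  simp [derivSubchain, subchain_self]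

/-- The product rule applied to the recursion; the sum without a factor `t` comes from the explicit
`t` in it. -/
theorem IsSymbol.derivSubchain_eq (h : IsSymbol S s c) (hμ : ∀ σ, ‖μ σ‖ = 1) (ht : |t| < 1)
    (w : List (Bool × G)) {i j : ℕ} (hij : i < j) (hj : j < w.length) (x : G) :
    derivSubchain S s μ t w i j x
      = μ (chargeAt w i) * ((if siteAt w i = x then derivSubchain S s μ t w (i + 1) j x else 0) +
        (∑ p ∈ Finset.Ioc i j,
          act S (subchain S s μ t w i p) x * subchain S s μ t w p j x +
        t * ∑ p ∈ Finset.Ioc i j,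
          (act S (derivSubchain S s μ t w i p) x * subchain S s μ t w p j x +
          act S (subchain S s μ t w i p) x * derivSubchain S s μ t w p j x))) := by
  have hM : ∀ i j x, HasDerivAt (fun u => subchain S s μ u w i j x)
      (derivSubchain S s μ t w i j x) t := fun i j x =>
    (h.differentiableAt_subchain hμ ht w i j x).hasDerivAt
  have hid : HasDerivAt (fun u : ℝ => (u : ℂ)) 1 t := by
    simpa using (hasDerivAt_id t).ofReal_comp
  have hR := ((show HasDerivAt (fun u => if siteAt w i = x then subchain S s μ u w (i + 1) j x
      else 0) (if siteAt w i = x then derivSubchain S s μ t w (i + 1) j x else 0) t by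
      split_ifs
      · exact hM _ _ _
      · exact hasDerivAt_const _ _).add (hid.mul (HasDerivAt.fun_sum (u := Finset.Ioc i j)
        fun p _ => (hasDerivAt_act (S := S) (hM i p) x).mul (hM p j x)))).const_mul
          (μ (chargeAt w i))
  have hev : (fun u => subchain S s μ u w i j x) =ᶠ[nhds t] fun u =>
      μ (chargeAt w i) * ((if siteAt w i = x then subchain S s μ u w (i + 1) j x else 0) +
        u * ∑ p ∈ Finset.Ioc i j,
          act S (subchain S s μ u w i p) x * subchain S s μ u w p j x) := by
    -- The recursion may be differentiated because it holds for all times near `t`.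
    filter_upwards [(isOpen_lt continuous_abs continuous_const).mem_nhds ht] with u hu
    exact h.subchain_eq hμ hu w hij hj x
  have := (hM i j x).unique (hR.congr_of_eventuallyEq hev)
  rw [one_mul] at this
  exact this

/-- The part of the left cut of a word at the positions `k < l` that lies between the original
positions `i` and `j`; zero unless `i ≤ k` and `l ≤ j`. -/
def cutSubchain (S : Matrix G G ℝ) (s : AddChar G ℂ → ℝ) (μ : Bool → ℂ) (t : ℝ)
    (w : List (Bool × G)) (k l : ℕ) (a : G) (i j : ℕ) (x : G) : ℂ :=
  if i ≤ k ∧ l ≤ j then subchain S s μ t (cutWord w k l a) i (j + (k + 1) - l) x else 0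

theorem subchain_cutWord_le {w : List (Bool × G)} {k l : ℕ} (a : G) (hk : k < w.length)
    (i : ℕ) {p : ℕ} (hp : p ≤ k) :
    subchain S s μ t (cutWord w k l a) i p = subchain S s μ t w i p := by
  funext x
  have : (cutWord w k l a).take p = w.take p := by
    rw [cutWord, List.take_append_of_le_length (by simp; omega), List.take_take, min_eq_left hp]
  rw [subchain, subchain, this, chargeAt_cutWord_le a hk hp]

theorem subchain_cutWord_gt {w : List (Bool × G)} {k l : ℕ} (a : G) (hk : k < w.length)
    {p j : ℕ} (hp : l ≤ p) (hj : l ≤ j) :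
    subchain S s μ t (cutWord w k l a) (p + (k + 1) - l) (j + (k + 1) - l)
      = subchain S s μ t w p j := by
  funext x
  have h1 : ((cutWord w k l a).take (j + (k + 1) - l)).drop (p + (k + 1) - l)
      = (w.take j).drop p := by
    apply List.ext_getElem?
    intro r
    simp only [List.getElem?_drop, List.getElem?_take]
    rw [show p + (k + 1) - l + r = (p + r) + (k + 1) - l by omega,
      cutWord_getElem?_gt a hk (by omega)]
    exact if_congr (by omega) rfl rfl
  rw [subchain, subchain, h1, chargeAt_cutWord_gt a hk hj]
  exact if_congr (by omega) rfl rfl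

theorem cutSubchain_of_not {w : List (Bool × G)} {k l : ℕ} {a : G} {i j : ℕ}
    (h : ¬ (i ≤ k ∧ l ≤ j)) : cutSubchain S s μ t w k l a i j = fun _ => 0 := by
  funext x; rw [cutSubchain, if_neg h]

theorem cutSubchain_of {w : List (Bool × G)} {k l : ℕ} {a : G} {i j : ℕ} (hi : i ≤ k) (hj : l ≤ j) :
    cutSubchain S s μ t w k l a i j
      = subchain S s μ t (cutWord w k l a) i (j + (k + 1) - l) := by
  funext x; rw [cutSubchain, if_pos ⟨hi, hj⟩]

/-- The recursion for the cut word, sorted by where the cut lies. If `k = i`, the first letter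
carries the new site `a` and the rest resumes at `l`. Otherwise the delta term keeps the cut, and an
intermediate vertex `p` lies either left of the cut, which then sits in the second factor, or right
of it, when the cut sits in the first. -/
theorem IsSymbol.cutSubchain_eq (h : IsSymbol S s c) (hμ : ∀ σ, ‖μ σ‖ = 1) (ht : |t| < 1)
    (w : List (Bool × G)) {k l : ℕ} (hkl : k < l) (hl : l < w.length) (a : G)
    {i j : ℕ} (hj : j < w.length) (x : G) :
    cutSubchain S s μ t w k l a i j x
      = μ (chargeAt w i) * ((if k = i then (if a = x then subchain S s μ t w l j x else 0) else 0) +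
        (if siteAt w i = x then cutSubchain S s μ t w k l a (i + 1) j x else 0) +
        t * ∑ p ∈ Finset.Ioc i j,
          (act S (subchain S s μ t w i p) x * cutSubchain S s μ t w k l a p j x +
          act S (cutSubchain S s μ t w k l a i p) x * subchain S s μ t w p j x)) := by
  have hk : k < w.length := by omega
  rcases lt_or_ge k i with hki | hki
  · have h0 : ∀ p ∈ Finset.Ioc i j,
        act S (subchain S s μ t w i p) x * cutSubchain S s μ t w k l a p j x +
          act S (cutSubchain S s μ t w k l a i p) x * subchain S s μ t w p j x = 0 := by
      intro p hp
      rw [Finset.mem_Ioc] at hp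
      rw [cutSubchain_of_not (i := p) (by omega), cutSubchain_of_not (i := i) (by omega), act_zero]
      simp
    rw [Finset.sum_eq_zero h0, if_neg (by omega), cutSubchain_of_not (by omega),
      cutSubchain_of_not (i := i + 1) (by omega)]
    simp
  rcases lt_or_ge j l with hjl | hjl
  · have h0 : ∀ p ∈ Finset.Ioc i j,
        act S (subchain S s μ t w i p) x * cutSubchain S s μ t w k l a p j x +
          act S (cutSubchain S s μ t w k l a i p) x * subchain S s μ t w p j x = 0 := by
      intro p hp
      rw [Finset.mem_Ioc] at hp
      rw [cutSubchain_of_not (i := p) (by omega), cutSubchain_of_not (i := i) (by omega), act_zero]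
      simp
    rw [Finset.sum_eq_zero h0, subchain_of_lt w hjl, cutSubchain_of_not (by omega),
      cutSubchain_of_not (i := i + 1) (by omega)]
    simp
  have key := h.subchain_eq hμ ht (cutWord w k l a) (i := i) (j := j + (k + 1) - l) (by omega)
    (by rw [cutWord_length a hk]; omega) x
  rw [cutSubchain_of hki hjl, key, chargeAt_cutWord_le a hk hki]
  congr 2
  · rcases hki.lt_or_eq with hik | rfl
    · rw [siteAt_cutWord_lt a hk hik, cutSubchain_of hik hjl, if_neg (show ¬ k = i by omega), zero_add]
    · have hc := subchain_cutWord_gt (S := S) (s := s) (μ := μ) (t := t) a hk le_rfl hjl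
      rw [show l + (i + 1) - l = i + 1 by omega] at hc
      rw [siteAt_cutWord_eq a hk, if_pos rfl, cutSubchain_of_not (i := i + 1) (by omega), hc]
      simp
  · congr 1
    rw [Finset.sum_add_distrib]
    -- Positions of the cut word up to `k` are original ones; those after `k` are the original
    -- positions `l, …, j`, shifted.
    have hI : Finset.Ioc i (j + (k + 1) - l) = Finset.Ioc i k ∪ Finset.Ioc k (j + (k + 1) - l) := by
      rw [Finset.Ioc_union_Ioc_eq_Ioc hki (by omega)]
    rw [hI, Finset.sum_union (Finset.disjoint_left.2 fun p hp hp' => by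
      simp only [Finset.mem_Ioc] at hp hp'; omega)]
    congr 1
    · have hsub : Finset.Ioc i k ⊆ Finset.Ioc i j := Finset.Ioc_subset_Ioc_right (by omega)
      rw [← Finset.sum_subset hsub (f := fun p => act S (subchain S s μ t w i p) x *
        cutSubchain S s μ t w k l a p j x)]
      · refine Finset.sum_congr rfl fun p hp => ?_
        rw [Finset.mem_Ioc] at hp
        rw [subchain_cutWord_le a hk i hp.2, cutSubchain_of hp.2 hjl]
      · intro p hp hp'
        simp only [Finset.mem_Ioc] at hp hp'
        rw [cutSubchain_of_not (by omega), mul_zero]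
    · have hsub : Finset.Icc l j ⊆ Finset.Ioc i j := by
        intro p; simp only [Finset.mem_Ioc, Finset.mem_Icc]; omega
      rw [← Finset.sum_subset hsub (f := fun p => act S (cutSubchain S s μ t w k l a i p) x *
        subchain S s μ t w p j x)]
      · refine Finset.sum_nbij' (fun p => p + l - (k + 1)) (fun q => q + (k + 1) - l) ?_ ?_ ?_ ?_ ?_
        · intro p; simp only [Finset.mem_Ioc, Finset.mem_Icc]; omega
        · intro p; simp only [Finset.mem_Ioc, Finset.mem_Icc]; omega
        · intro p; simp only [Finset.mem_Ioc]; omega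
        · intro p; simp only [Finset.mem_Icc]; omega
        · intro p hp
          rw [Finset.mem_Ioc] at hp
          rw [cutSubchain_of hki (by omega), ← subchain_cutWord_gt (k := k) a hk
            (show l ≤ p + l - (k + 1) by omega) hjl,
            show p + l - (k + 1) + (k + 1) - l = p by omega]
      · intro p hp hp'
        simp only [Finset.mem_Ioc, Finset.mem_Icc] at hp hp'
        rw [cutSubchain_of_not (by omega), act_zero, zero_mul]

/-- The right-hand side of the primitive equation for a subchain, normalised to `W = 1`. -/
def primitiveSum (S : Matrix G G ℝ) (s : AddChar G ℂ → ℝ) (μ : Bool → ℂ) (t : ℝ)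
    (w : List (Bool × G)) (i j : ℕ) (x : G) : ℂ :=
  ∑ k ∈ Finset.range w.length, ∑ l ∈ Finset.Ioo k w.length, ∑ a : G,
    act S (subchain S s μ t w k l) a * cutSubchain S s μ t w k l a i j x

theorem primitiveSum_self (w : List (Bool × G)) (j : ℕ) (x : G) :
    primitiveSum S s μ t w j j x = 0 := by
  refine Finset.sum_eq_zero fun k _ => Finset.sum_eq_zero fun l hl =>
    Finset.sum_eq_zero fun a _ => ?_
  rw [Finset.mem_Ioo] at hl
  rw [cutSubchain_of_not (by omega), mul_zero]

theorem act_primitiveSum (w : List (Bool × G)) (i j : ℕ) (x : G) :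
    act S (primitiveSum S s μ t w i j) x
      = ∑ k ∈ Finset.range w.length, ∑ l ∈ Finset.Ioo k w.length, ∑ a : G,
        act S (subchain S s μ t w k l) a * act S (cutSubchain S s μ t w k l a i j) x := by
  unfold primitiveSum
  simp only [act_sum, act_const_mul]

/-- Summing the recursion of the cut chains over all cuts yields exactly the differentiated
recursion. -/
theorem IsSymbol.primitiveSum_eq (h : IsSymbol S s c) (hμ : ∀ σ, ‖μ σ‖ = 1) (ht : |t| < 1)
    (w : List (Bool × G)) {i j : ℕ} (hij : i < j) (hj : j < w.length) (x : G) :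
    primitiveSum S s μ t w i j x
      = μ (chargeAt w i) * ((if siteAt w i = x then primitiveSum S s μ t w (i + 1) j x else 0) +
        (∑ p ∈ Finset.Ioc i j,
          act S (subchain S s μ t w i p) x * subchain S s μ t w p j x +
        t * ∑ p ∈ Finset.Ioc i j,
          (act S (primitiveSum S s μ t w i p) x * subchain S s μ t w p j x +
          act S (subchain S s μ t w i p) x * primitiveSum S s μ t w p j x))) := by
  have e1 : primitiveSum S s μ t w i j x = μ (chargeAt w i) *
      (∑ k ∈ Finset.range w.length, ∑ l ∈ Finset.Ioo k w.length, ∑ a : G,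
        act S (subchain S s μ t w k l) a *
          (if k = i then (if a = x then subchain S s μ t w l j x else 0) else 0) +
      (∑ k ∈ Finset.range w.length, ∑ l ∈ Finset.Ioo k w.length, ∑ a : G,
        act S (subchain S s μ t w k l) a *
          (if siteAt w i = x then cutSubchain S s μ t w k l a (i + 1) j x else 0)) +
      t * ∑ k ∈ Finset.range w.length, ∑ l ∈ Finset.Ioo k w.length, ∑ a : G,
        act S (subchain S s μ t w k l) a * ∑ p ∈ Finset.Ioc i j,
          (act S (subchain S s μ t w i p) x * cutSubchain S s μ t w k l a p j x +
          act S (cutSubchain S s μ t w k l a i p) x * subchain S s μ t w p j x)) := by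
    rw [primitiveSum, Finset.mul_sum, ← Finset.sum_add_distrib, ← Finset.sum_add_distrib,
      Finset.mul_sum]
    refine Finset.sum_congr rfl fun k hk => ?_
    rw [Finset.mul_sum, ← Finset.sum_add_distrib, ← Finset.sum_add_distrib, Finset.mul_sum]
    refine Finset.sum_congr rfl fun l hl => ?_
    rw [Finset.mul_sum, ← Finset.sum_add_distrib, ← Finset.sum_add_distrib, Finset.mul_sum]
    refine Finset.sum_congr rfl fun a _ => ?_
    rw [Finset.mem_Ioo] at hl
    rw [h.cutSubchain_eq hμ ht w hl.1 hl.2 a hj x]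
    ring
  -- Cuts at the first vertex with `a = x` and `l = p` play the role of the derivative of the
  -- explicit factor `t`.
  have e2 : ∑ k ∈ Finset.range w.length, ∑ l ∈ Finset.Ioo k w.length, ∑ a : G,
        act S (subchain S s μ t w k l) a *
          (if k = i then (if a = x then subchain S s μ t w l j x else 0) else 0)
      = ∑ p ∈ Finset.Ioc i j, act S (subchain S s μ t w i p) x * subchain S s μ t w p j x := by
    rw [Finset.sum_eq_single i]
    · have hsub : Finset.Ioc i j ⊆ Finset.Ioo i w.length := by
        intro p; simp only [Finset.mem_Ioc, Finset.mem_Ioo]; omega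
      simp only [if_true, mul_ite, mul_zero, Finset.sum_ite_eq', Finset.mem_univ]
      symm
      refine Finset.sum_subset hsub fun p hp hp' => ?_
      simp only [Finset.mem_Ioc, Finset.mem_Ioo] at hp hp'
      rw [subchain_of_lt w (by omega), mul_zero]
    · intro k _ hk
      simp [hk]
    · intro hi; simp at hi; omega
  have e3 : ∑ k ∈ Finset.range w.length, ∑ l ∈ Finset.Ioo k w.length, ∑ a : G,
        act S (subchain S s μ t w k l) a *
          (if siteAt w i = x then cutSubchain S s μ t w k l a (i + 1) j x else 0)
      = if siteAt w i = x then primitiveSum S s μ t w (i + 1) j x else 0 := by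
    split_ifs
    · rfl
    · simp
  have e4 : ∑ k ∈ Finset.range w.length, ∑ l ∈ Finset.Ioo k w.length, ∑ a : G,
        act S (subchain S s μ t w k l) a * ∑ p ∈ Finset.Ioc i j,
          (act S (subchain S s μ t w i p) x * cutSubchain S s μ t w k l a p j x +
          act S (cutSubchain S s μ t w k l a i p) x * subchain S s μ t w p j x)
      = ∑ p ∈ Finset.Ioc i j,
          (act S (primitiveSum S s μ t w i p) x * subchain S s μ t w p j x +
          act S (subchain S s μ t w i p) x * primitiveSum S s μ t w p j x) := by
    have e5 : ∀ p, act S (primitiveSum S s μ t w i p) x * subchain S s μ t w p j x +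
          act S (subchain S s μ t w i p) x * primitiveSum S s μ t w p j x
        = ∑ k ∈ Finset.range w.length, ∑ l ∈ Finset.Ioo k w.length, ∑ a : G,
        act S (subchain S s μ t w k l) a *
          (act S (subchain S s μ t w i p) x * cutSubchain S s μ t w k l a p j x +
          act S (cutSubchain S s μ t w k l a i p) x * subchain S s μ t w p j x) := by
      intro p
      rw [act_primitiveSum, primitiveSum, Finset.sum_mul, Finset.mul_sum, ← Finset.sum_add_distrib]
      refine Finset.sum_congr rfl fun k _ => ?_
      rw [Finset.sum_mul, Finset.mul_sum, ← Finset.sum_add_distrib]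
      refine Finset.sum_congr rfl fun l _ => ?_
      rw [Finset.sum_mul, Finset.mul_sum, ← Finset.sum_add_distrib]
      exact Finset.sum_congr rfl fun a _ => by ring
    simp only [e5, Finset.mul_sum]
    symm
    rw [Finset.sum_comm]
    refine Finset.sum_congr rfl fun k _ => ?_
    rw [Finset.sum_comm]
    refine Finset.sum_congr rfl fun l _ => ?_
    rw [Finset.sum_comm]
  rw [e1, e2, e3, e4]
  ring

/-- Both sides obey the same recursion. By induction on the gap all shorter terms agree, so the
difference `f` solves `f = t μ_i μ_j S f` and vanishes. -/
theorem IsSymbol.derivSubchain_eq_primitiveSum (h : IsSymbol S s c) (hμ : ∀ σ, ‖μ σ‖ = 1)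
    (ht : |t| < 1) (w : List (Bool × G)) {i j : ℕ} (hij : i ≤ j) (hj : j < w.length) (x : G) :
    derivSubchain S s μ t w i j x = primitiveSum S s μ t w i j x := by
  induction hn : j - i using Nat.strong_induction_on generalizing i j x with
  | _ n ih =>
  rcases hij.eq_or_lt with rfl | hij'
  · rw [derivSubchain_self, primitiveSum_self]
  have hζ : ‖(t * (μ (chargeAt w i) * μ (chargeAt w j)) : ℂ)‖ < 1 := by
    rw [norm_mul, norm_mul, hμ, hμ, Complex.norm_real]; simpa using ht
  have hI : Finset.Ioc i j = insert j (Finset.Ioo i j) := (Finset.Ioo_insert_right hij').symm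
  refine sub_eq_zero.1 (h.eq_zero_of_sub_act hζ (f := fun x =>
    derivSubchain S s μ t w i j x - primitiveSum S s μ t w i j x) (fun y => ?_) x)
  rw [act_sub]
  have h1 := h.derivSubchain_eq hμ ht w hij' hj y
  have h2 := h.primitiveSum_eq hμ ht w hij' hj y
  have h3 : (if siteAt w i = y then derivSubchain S s μ t w (i + 1) j y else 0)
      = if siteAt w i = y then primitiveSum S s μ t w (i + 1) j y else 0 := by
    split_ifs
    · exact ih _ (by omega) hij' hj y rfl
    · rfl
  have h4 : ∑ p ∈ Finset.Ioo i j,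
          (act S (derivSubchain S s μ t w i p) y * subchain S s μ t w p j y +
          act S (subchain S s μ t w i p) y * derivSubchain S s μ t w p j y)
      = ∑ p ∈ Finset.Ioo i j,
          (act S (primitiveSum S s μ t w i p) y * subchain S s μ t w p j y +
          act S (subchain S s μ t w i p) y * primitiveSum S s μ t w p j y) := by
    refine Finset.sum_congr rfl fun p hp => ?_
    rw [Finset.mem_Ioo] at hp
    rw [ih _ (by omega) hp.2.le hj y rfl, show derivSubchain S s μ t w i p
      = primitiveSum S s μ t w i p from
      funext fun z => ih _ (by omega) hp.1.le (hp.2.trans hj) z rfl]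
  rw [hI, Finset.sum_insert (by simp), Finset.sum_insert (by simp), h3, h4, derivSubchain_self,
    subchain_self] at h1
  rw [hI, Finset.sum_insert (by simp), Finset.sum_insert (by simp), primitiveSum_self,
    subchain_self] at h2
  linear_combination h1 - h2

theorem IsSymbol.hasDerivAt_subchain (h : IsSymbol S s c) (hμ : ∀ σ, ‖μ σ‖ = 1)
    (ht : |t| < 1) (w : List (Bool × G)) {i j : ℕ} (hij : i ≤ j) (hj : j < w.length) (x : G) :
    HasDerivAt (fun u => subchain S s μ u w i j x) (primitiveSum S s μ t w i j x) t := by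
  rw [← h.derivSubchain_eq_primitiveSum hμ ht w hij hj x]
  exact (h.differentiableAt_subchain hμ ht w i j x).hasDerivAt

end Derivative

/-! ### Weighted Fourier bounds -/

section Resolvent

variable {G : Type*} [AddCommGroup G] [Fintype G]
variable {S : Matrix G G ℝ} {s : AddChar G ℂ → ℝ} {c t : ℝ}

/-- `f` is of the form `(1 - t S)⁻¹ F`, where the Fourier transform of `F` is bounded by `A`. -/
def ResolventBound (s : AddChar G ℂ → ℝ) (t A : ℝ) (f : G → ℂ) : Prop :=
  ∀ χ, (1 - t * s χ) * ‖ft f χ‖ ≤ A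

/-- The diagonal entry of `(1 - t S)⁻¹`. -/
def resolventDiag (s : AddChar G ℂ → ℝ) (t : ℝ) : ℝ :=
  (Fintype.card G : ℝ)⁻¹ * ∑ χ, (1 - t * s χ)⁻¹

theorem IsSymbol.one_sub_le (h : IsSymbol S s c) (h0 : 0 ≤ t) (χ : AddChar G ℂ) :
    1 - t ≤ 1 - t * s χ := by
  have := h.le_one χ
  nlinarith

theorem IsSymbol.one_sub_pos (h : IsSymbol S s c) (h0 : 0 ≤ t) (h1 : t < 1) (χ : AddChar G ℂ) :
    0 < 1 - t * s χ := by
  have := h.one_sub_le h0 χ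
  linarith

theorem IsSymbol.one_sub_le_two (h : IsSymbol S s c) (h0 : 0 ≤ t) (h1 : t < 1) (χ : AddChar G ℂ) :
    1 - t * s χ ≤ 2 := by
  have := h.lower χ; have := h.pos
  nlinarith

theorem IsSymbol.resolventDiag_nonneg (h : IsSymbol S s c) (h0 : 0 ≤ t) (h1 : t < 1) :
    0 ≤ resolventDiag s t := by
  have := fun χ => (h.one_sub_pos h0 h1 χ).le
  unfold resolventDiag
  exact mul_nonneg (by positivity) (Finset.sum_nonneg fun χ _ => inv_nonneg.2 (this χ))

theorem ResolventBound.mono {A B : ℝ} {f : G → ℂ} (hf : ResolventBound s t A f) (hAB : A ≤ B) :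
    ResolventBound s t B f := fun χ => (hf χ).trans hAB

theorem ResolventBound.nonneg (h : IsSymbol S s c) (h0 : 0 ≤ t) (h1 : t < 1) {A : ℝ} {f : G → ℂ}
    (hf : ResolventBound s t A f) : 0 ≤ A :=
  le_trans (mul_nonneg (h.one_sub_pos h0 h1 0).le (norm_nonneg _)) (hf (0 : AddChar G ℂ))

theorem ResolventBound.wienerNorm_le (h : IsSymbol S s c) (h0 : 0 ≤ t) (h1 : t < 1) {A : ℝ}
    {f : G → ℂ} (hf : ResolventBound s t A f) : wienerNorm f ≤ A * resolventDiag s t := by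
  unfold wienerNorm resolventDiag
  rw [mul_left_comm]
  refine mul_le_mul_of_nonneg_left ?_ (by positivity)
  rw [Finset.mul_sum]
  refine Finset.sum_le_sum fun χ _ => ?_
  rw [← div_eq_mul_inv, le_div_iff₀ (h.one_sub_pos h0 h1 χ), mul_comm]
  exact hf χ

theorem ResolventBound.norm_le (h : IsSymbol S s c) (h0 : 0 ≤ t) (h1 : t < 1) {A : ℝ}
    {f : G → ℂ} (hf : ResolventBound s t A f) (x : G) : ‖f x‖ ≤ A * resolventDiag s t :=
  (norm_le_wienerNorm f x).trans (hf.wienerNorm_le h h0 h1)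

theorem ResolventBound.norm_ft_le (h : IsSymbol S s c) (h0 : 0 ≤ t) (h1 : t < 1) {A : ℝ}
    {f : G → ℂ} (hf : ResolventBound s t A f) (χ : AddChar G ℂ) : ‖ft f χ‖ ≤ A / (1 - t) := by
  rw [le_div_iff₀ (by linarith), mul_comm]
  exact (mul_le_mul_of_nonneg_right (h.one_sub_le h0 χ) (norm_nonneg _)).trans (hf χ)

theorem IsSymbol.norm_ft_act_le (h : IsSymbol S s c) (f : G → ℂ) (χ : AddChar G ℂ) :
    ‖ft (act S f) χ‖ ≤ ‖ft f χ‖ := by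
  rw [h.ft_act, norm_mul, Complex.norm_real, Real.norm_eq_abs]
  exact mul_le_of_le_one_left (norm_nonneg _) (h.abs_le_one χ)

theorem ResolventBound.act (h : IsSymbol S s c) (h0 : 0 ≤ t) (h1 : t < 1) {A : ℝ}
    {f : G → ℂ} (hf : ResolventBound s t A f) : ResolventBound s t A (act S f) := fun χ =>
  (mul_le_mul_of_nonneg_left (h.norm_ft_act_le f χ) (h.one_sub_pos h0 h1 χ).le).trans (hf χ)

theorem ResolventBound.norm_ft_sub_act_le (h : IsSymbol S s c) (h0 : 0 ≤ t) (h1 : t < 1) {A : ℝ}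
    {f : G → ℂ} (hf : ResolventBound s t A f) (χ : AddChar G ℂ) :
    ‖ft (fun x => f x - t * _root_.act S f x) χ‖ ≤ A := by
  have e : (1 - (t : ℂ) * s χ) = ((1 - t * s χ : ℝ) : ℂ) := by push_cast; ring
  rw [h.ft_sub_act, norm_mul, e, Complex.norm_real, Real.norm_of_nonneg (h.one_sub_pos h0 h1 χ).le]
  exact hf χ

/-- One factor is taken in `ℓ^∞` on the Fourier side, which costs `1 / (1 - t)`, the other in `ℓ¹`.
This is efficient only when `1 - t` is comparable to `ω`. -/
theorem ResolventBound.norm_ft_mul_le (h : IsSymbol S s c) (h0 : 0 ≤ t) (h1 : t < 1) {A B : ℝ}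
    {f g : G → ℂ} (hf : ResolventBound s t A f) (hg : ResolventBound s t B g) (χ : AddChar G ℂ) :
    ‖ft (fun x => f x * g x) χ‖ ≤ A * B * resolventDiag s t / (1 - t) := by
  refine (norm_ft_mul_le_of_left (hf.norm_ft_le h h0 h1) χ).trans ?_
  have hA := hf.nonneg h h0 h1
  have ht : 0 < 1 - t := by linarith
  calc A / (1 - t) * wienerNorm g ≤ A / (1 - t) * (B * resolventDiag s t) :=
        mul_le_mul_of_nonneg_left (hg.wienerNorm_le h h0 h1) (by positivity)
    _ = _ := by ring

/-- Subadditivity moves the weight `1 - t s(χ)` onto one factor of the convolution; the other factor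
is then summed, which gives the diagonal entry of the resolvent and no loss in `1 - t`. -/
theorem ResolventBound.mul (h : IsSymbol S s c) (h0 : 0 ≤ t) (h1 : t < 1) {A B : ℝ}
    {f g : G → ℂ} (hf : ResolventBound s t A f) (hg : ResolventBound s t B g) :
    ResolventBound s t (4 * A * B * resolventDiag s t) (fun x => f x * g x) := by
  intro χ
  have hA := hf.nonneg h h0 h1
  have hB := hg.nonneg h h0 h1
  have hsub : ∀ ψ : AddChar G ℂ,
      1 - t * s χ ≤ 2 * (1 - t * s ψ) + 2 * (1 - t * s (χ - ψ)) := by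
    -- Follows from `1 - t s = (1 - t) + t (1 - s)` and `1 - t ≤ 4 (1 - t)`.
    intro ψ
    have := h.subadd ψ (χ - ψ)
    rw [add_sub_cancel] at this
    nlinarith
  have hN : (0 : ℝ) ≤ (Fintype.card G : ℝ)⁻¹ := by positivity
  calc (1 - t * s χ) * ‖ft (fun x => f x * g x) χ‖
      ≤ (1 - t * s χ) * ((Fintype.card G : ℝ)⁻¹ *
          ∑ ψ : AddChar G ℂ, ‖ft f ψ‖ * ‖ft g (χ - ψ)‖) :=
        mul_le_mul_of_nonneg_left (_root_.norm_ft_mul_le f g χ) (h.one_sub_pos h0 h1 χ).le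
    _ = (Fintype.card G : ℝ)⁻¹ *
          ∑ ψ : AddChar G ℂ, (1 - t * s χ) * (‖ft f ψ‖ * ‖ft g (χ - ψ)‖) := by
        rw [← Finset.mul_sum]; ring
    _ ≤ (Fintype.card G : ℝ)⁻¹ *
          ∑ ψ : AddChar G ℂ, (2 * A * ‖ft g (χ - ψ)‖ + 2 * B * ‖ft f ψ‖) := by
        refine mul_le_mul_of_nonneg_left (Finset.sum_le_sum fun ψ _ => ?_) hN
        have h2 := hf ψ
        have h3 := hg (χ - ψ)
        have n1 := norm_nonneg (ft f ψ)
        have n2 := norm_nonneg (ft g (χ - ψ))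
        calc (1 - t * s χ) * (‖ft f ψ‖ * ‖ft g (χ - ψ)‖)
            ≤ (2 * (1 - t * s ψ) + 2 * (1 - t * s (χ - ψ))) * (‖ft f ψ‖ * ‖ft g (χ - ψ)‖) :=
              mul_le_mul_of_nonneg_right (hsub ψ) (by positivity)
          _ = 2 * ((1 - t * s ψ) * ‖ft f ψ‖) * ‖ft g (χ - ψ)‖ +
              2 * ((1 - t * s (χ - ψ)) * ‖ft g (χ - ψ)‖) * ‖ft f ψ‖ := by ring
          _ ≤ _ := by gcongr
    _ = 2 * A * wienerNorm g + 2 * B * wienerNorm f := by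
        rw [Finset.sum_add_distrib, ← Finset.mul_sum, ← Finset.mul_sum, sum_norm_ft_sub, wienerNorm,
          wienerNorm]
        ring
    _ ≤ 2 * A * (B * resolventDiag s t) + 2 * B * (A * resolventDiag s t) := by
        gcongr
        · exact hg.wienerNorm_le h h0 h1
        · exact hf.wienerNorm_le h h0 h1
    _ = _ := by ring

theorem norm_ft_sum_le {ι : Type*} (I : Finset ι) (f : ι → G → ℂ) {B : ℝ} (χ : AddChar G ℂ)
    (hf : ∀ i ∈ I, ‖ft (f i) χ‖ ≤ B) : ‖ft (fun x => ∑ i ∈ I, f i x) χ‖ ≤ I.card * B := by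
  rw [ft_sum]
  refine (norm_sum_le _ _).trans ((Finset.sum_le_sum hf).trans ?_)
  simp

/-- Lower bound for the spectrum of `1 - t m² S` at a point `m` of the unit circle. -/
theorem IsSymbol.norm_one_sub_sq_ge (h : IsSymbol S s c) (h0 : 0 ≤ t) (h1 : t < 1) {m : ℂ}
    (hm : ‖m‖ = 1) {r : ℝ} (hr : 0 ≤ r) (hrm : r ≤ 2 * |m.im|) (χ : AddChar G ℂ) :
    min (1 / 2) c / 4 * (1 - t + r) ≤ ‖1 - t * m * m * s χ‖ := by
  have hc := h.pos
  set y : ℝ := t * s χ with hy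
  set q := min (1 / 2) c with hq
  have hq0 : 0 < q := lt_min (by norm_num) hc
  have hq1 : q ≤ 1 / 2 := min_le_left _ _
  have hq2 : q ≤ c := min_le_right _ _
  have e : (1 - t * m * m * s χ : ℂ) = 1 - y * (m * m) := by rw [hy]; push_cast; ring
  rw [e]
  have hsq : m.re ^ 2 + m.im ^ 2 = 1 := by
    have := Complex.sq_norm m
    rw [hm, Complex.normSq_apply] at this
    nlinarith
  set ρ := |m.im| with hρ
  have hρ2 : ρ ^ 2 = m.im ^ 2 := sq_abs _
  have hρ0 : 0 ≤ ρ := abs_nonneg _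
  have hρ1 : ρ ≤ 1 := by nlinarith [sq_nonneg m.re]
  have hmm : ‖(y * (m * m) : ℂ)‖ = |y| := by
    rw [norm_mul, norm_mul, hm, Complex.norm_real]; simp
  have hge : 1 - |y| ≤ ‖(1 - y * (m * m) : ℂ)‖ := by
    have := norm_sub_norm_le (1 : ℂ) (y * (m * m))
    rwa [hmm, norm_one] at this
  have hyt : |y| ≤ t := by
    rw [hy, abs_mul, abs_of_nonneg h0]
    exact mul_le_of_le_one_right h0 (h.abs_le_one χ)
  -- On the unit circle `Re m² = 1 - 2 (Im m)²`.
  have hn : ‖(1 - y * (m * m) : ℂ)‖ ^ 2 = (1 - y) ^ 2 + 4 * y * ρ ^ 2 := by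
    rw [Complex.sq_norm, Complex.normSq_apply, hρ2]
    simp
    linear_combination (-2 * y + y ^ 2 * (m.re ^ 2 + m.im ^ 2 + 1)) * hsq
  have hn0 := norm_nonneg (1 - y * (m * m) : ℂ)
  -- For `y ≥ 1/4` the term `4 y ρ²` suffices, for `0 ≤ y ≤ 1/4` the term `(1 - y)²`. For `y < 0`
  -- the spectrum of `S` stays away from `-1`.
  have hlow : q * ρ ≤ ‖(1 - y * (m * m) : ℂ)‖ := by
    rcases le_or_gt 0 y with hy0 | hy0
    · have : (q * ρ) ^ 2 ≤ ‖(1 - y * (m * m) : ℂ)‖ ^ 2 := by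
        rw [hn]
        have h4 : (q * ρ) ^ 2 ≤ ρ ^ 2 / 4 := by
          have hq3 : q ^ 2 ≤ 1 / 4 := by nlinarith
          rw [mul_pow]
          linarith [mul_le_mul_of_nonneg_right hq3 (sq_nonneg ρ)]
        rcases le_or_gt (1 / 4) y with hy1 | hy1
        · nlinarith [sq_nonneg ρ, sq_nonneg (1 - y)]
        · nlinarith [sq_nonneg ρ, mul_nonneg hy0 (sq_nonneg ρ)]
      exact le_of_abs_le (abs_le_of_sq_le_sq this hn0)
    · have h5 : c ≤ 1 - |y| := by
        rw [abs_of_neg hy0, hy]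
        have := h.lower χ
        have hs : s χ < 0 := by
          by_contra hs; push Not at hs
          have := mul_nonneg h0 hs
          linarith
        nlinarith
      nlinarith
  -- The average of the lower bounds `1 - t` and `q ρ`.
  have hq4 : q / 4 * (1 - t + r) ≤ (1 - t) / 2 + q * ρ / 2 := by
    have : q * r ≤ q * (2 * ρ) := mul_le_mul_of_nonneg_left hrm hq0.le
    nlinarith
  linarith
end Resolvent

/-! ### Charges and flow points on the unit circle -/

theorem norm_chargedM {m : ℂ} (hm : ‖m‖ = 1) (σ : Bool) : ‖chargedM m σ‖ = 1 := by
  cases σ <;> simp [chargedM, hm]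

theorem abs_im_chargedM (m : ℂ) (σ : Bool) : |(chargedM m σ).im| = |m.im| := by
  cases σ <;> simp [chargedM]

theorem chargedM_mul_of_ne {m : ℂ} (hm : ‖m‖ = 1) {σ σ' : Bool} (h : σ ≠ σ') :
    chargedM m σ * chargedM m σ' = 1 := by
  have h1 : m * (starRingEnd ℂ) m = 1 := by
    rw [Complex.mul_conj, Complex.normSq_eq_norm_sq, hm]; simp
  cases σ <;> cases σ' <;> simp_all [chargedM, mul_comm]

theorem norm_chargedM_sub_of_ne (m : ℂ) {σ σ' : Bool} (h : σ ≠ σ') :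
    ‖chargedM m σ' - chargedM m σ‖ = 2 * |m.im| := by
  have h1 : ‖m - (starRingEnd ℂ) m‖ = 2 * |m.im| := by
    rw [Complex.sub_conj]; simp
  cases σ <;> cases σ' <;> simp_all [chargedM]
  rw [norm_sub_rev, h1]

/-- `m` is a point of the unit circle with `|Im m|` comparable to `r`, and `t ∈ [0, 1)`. -/
structure IsFlowPoint (m : ℂ) (t r : ℝ) : Prop where
  norm_eq : ‖m‖ = 1
  nonneg : 0 ≤ t
  lt_one : t < 1
  r_nonneg : 0 ≤ r
  r_le : r ≤ 2
  r_le_im : r ≤ 2 * |m.im|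
  im_le_r : |m.im| ≤ r

section FlowPoint

variable {G : Type*} [AddCommGroup G] [Fintype G]
variable {S : Matrix G G ℝ} {s : AddChar G ℂ → ℝ} {c t r : ℝ} {m : ℂ}

theorem IsFlowPoint.abs_lt_one (hF : IsFlowPoint m t r) : |t| < 1 := by
  rw [abs_of_nonneg hF.nonneg]; exact hF.lt_one

theorem IsFlowPoint.pos (hF : IsFlowPoint m t r) : 0 < 1 - t + r := by
  have := hF.lt_one; have := hF.r_nonneg; linarith

theorem IsFlowPoint.spectral_le (hF : IsFlowPoint m t r) (h : IsSymbol S s c) (σ : Bool)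
    (χ : AddChar G ℂ) :
    min (1 / 2) c / 4 * (1 - t + r) ≤ ‖1 - t * chargedM m σ * chargedM m σ * s χ‖ :=
  h.norm_one_sub_sq_ge hF.nonneg hF.lt_one (norm_chargedM hF.norm_eq σ) hF.r_nonneg
    (by rw [abs_im_chargedM]; exact hF.r_le_im) χ

end FlowPoint

/-! ### Inductive estimate of the chains -/

section Bounds

variable {G : Type*} [AddCommGroup G] [Fintype G] [DecidableEq G]
variable {S : Matrix G G ℝ} {s : AddChar G ℂ → ℝ} {c t r : ℝ} {m : ℂ}

theorem subchain_append (μ : Bool → ℂ) (p : List (Bool × G)) (σ : Bool) (a : G) :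
    subchain S s μ t (p ++ [(σ, a)]) 0 p.length = chain S s μ t p σ := by
  funext x
  simp [subchain, chargeAt]

theorem exists_subchain_eq_chain (μ : Bool → ℂ) {w : List (Bool × G)} {i j : ℕ} (hij : i ≤ j)
    (hj : j < w.length) :
    ∃ q σ, q.length = j - i ∧ subchain S s μ t w i j = chain S s μ t q σ := by
  refine ⟨(w.take j).drop i, chargeAt w j, by simp; omega, ?_⟩
  funext x
  rw [subchain, if_pos hij]

/-- The source term of the equation for a subchain. -/
def chainSource (S : Matrix G G ℝ) (s : AddChar G ℂ → ℝ) (μ : Bool → ℂ) (t : ℝ)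
    (w : List (Bool × G)) (L : ℕ) (x : G) : ℂ :=
  μ (chargeAt w 0) * ((if siteAt w 0 = x then subchain S s μ t w 1 L x else 0) +
    t * ∑ p ∈ Finset.Ico 1 L, act S (subchain S s μ t w 0 p) x * subchain S s μ t w p L x)

/-- Isolates the unknown, so that the remaining source contains only strictly shorter chains. -/
theorem IsSymbol.sub_act_eq_chainSource (h : IsSymbol S s c) {μ : Bool → ℂ} (hμ : ∀ σ, ‖μ σ‖ = 1)
    (ht : |t| < 1) (w : List (Bool × G)) {L : ℕ} (hL : 1 ≤ L) (hw : L < w.length) (x : G) :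
    subchain S s μ t w 0 L x - t * μ (chargeAt w 0) * μ (chargeAt w L) *
      act S (subchain S s μ t w 0 L) x = chainSource S s μ t w L x := by
  have r1 := h.subchain_eq hμ ht w (i := 0) (j := L) (by omega) hw x
  have hI : Finset.Ioc 0 L = Finset.Ico 1 (L + 1) := by ext; simp; omega
  rw [hI, Finset.sum_Ico_succ_top hL, subchain_self, zero_add] at r1
  rw [chainSource]
  linear_combination r1

theorem norm_ft_chainSource_le {μ : Bool → ℂ} (hμ : ∀ σ, ‖μ σ‖ = 1) (h0 : 0 ≤ t) (h1 : t < 1)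
    (w : List (Bool × G)) (L : ℕ) {A B : ℝ} (hA : ∀ x, ‖subchain S s μ t w 1 L x‖ ≤ A)
    (χ : AddChar G ℂ)
    (hB : ∀ p ∈ Finset.Ico 1 L,
      ‖ft (fun x => act S (subchain S s μ t w 0 p) x * subchain S s μ t w p L x) χ‖ ≤ B) :
    ‖ft (chainSource S s μ t w L) χ‖ ≤ A + (L - 1 : ℕ) * B := by
  unfold chainSource
  rw [ft_const_mul, ft_add, ft_const_mul, norm_mul, hμ, one_mul]
  refine (norm_add_le _ _).trans (add_le_add ((norm_ft_dirac_le _ _ χ).trans (hA _)) ?_)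
  rw [norm_mul, Complex.norm_real, Real.norm_of_nonneg h0]
  refine (mul_le_of_le_one_left (norm_nonneg _) h1.le).trans ?_
  refine (norm_ft_sum_le _ _ χ hB).trans ?_
  simp

/-- The constants of the inductive estimate of chains. -/
def stepConst (c C : ℝ) (L : ℕ) : ℝ :=
  C + (2 * C + 4 * (L - 1 : ℕ) * C ^ 2) * ((min (1 / 2) c / 4)⁻¹ + 2)

/-- The estimate of all subchains of gap less than `L`. -/
def SubchainBound (S : Matrix G G ℝ) (s : AddChar G ℂ → ℝ) (m : ℂ) (t r C : ℝ)
    (w : List (Bool × G)) (L : ℕ) : Prop :=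
  ∀ i j, i < j → j < w.length → j - i < L →
    ResolventBound s t (C * (resolventDiag s t / (1 - t + r)) ^ (j - i - 1))
      (subchain S s (chargedM m) t w i j)

/-- The weighted source is of order `b (b / ω) ^ (L - 2)` by the product rule, and dividing by the
symbol `1 - t μ² s ≳ ω` supplies the missing `1 / ω`. -/
theorem SubchainBound.step_same (hF : IsFlowPoint m t r) (h : IsSymbol S s c) {C : ℝ} (hC : 0 ≤ C)
    {w : List (Bool × G)} {L : ℕ} (hL : 2 ≤ L) (hw : w.length = L + 1)
    (hB : SubchainBound S s m t r C w L) (hσ : chargeAt w 0 = chargeAt w L) :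
    ResolventBound s t ((2 * C + 4 * (L - 1 : ℕ) * C ^ 2) * (min (1 / 2) c / 4)⁻¹ *
      (resolventDiag s t / (1 - t + r)) ^ (L - 1)) (subchain S s (chargedM m) t w 0 L) := by
  intro χ
  have hω := hF.pos
  have hμ := norm_chargedM hF.norm_eq
  have hb := h.resolventDiag_nonneg hF.nonneg hF.lt_one
  set b := resolventDiag s t
  set ω := 1 - t + r
  set X := b / ω
  have hX : 0 ≤ X := by positivity
  have hpos := h.one_sub_pos hF.nonneg hF.lt_one χ
  have hγ : 0 < min (1 / 2) c / 4 := div_pos (lt_min (by norm_num) h.pos) (by norm_num)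
  set γ := min (1 / 2) c / 4
  have heq : ft (chainSource S s (chargedM m) t w L) χ
      = (1 - t * chargedM m (chargeAt w L) * chargedM m (chargeAt w L) * s χ) *
        ft (subchain S s (chargedM m) t w 0 L) χ := by
    rw [← h.ft_sub_act]
    congr 1
    funext x
    rw [← h.sub_act_eq_chainSource hμ hF.abs_lt_one w (by omega) (by omega) x, hσ]
  have hsrc : (1 - t * s χ) * ‖ft (chainSource S s (chargedM m) t w L) χ‖
      ≤ (2 * C + 4 * (L - 1 : ℕ) * C ^ 2) * (X ^ (L - 2) * b) := by
    have h1 : ∀ x, ‖subchain S s (chargedM m) t w 1 L x‖ ≤ C * X ^ (L - 2) * b := fun x => by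
      have := (hB 1 L (by omega) (by omega) (by omega)).norm_le h hF.nonneg hF.lt_one x
      rwa [Nat.sub_sub] at this
    have h2 : ∀ p ∈ Finset.Ico 1 L, ‖ft (fun x => act S (subchain S s (chargedM m) t w 0 p) x *
        subchain S s (chargedM m) t w p L x) χ‖
        ≤ 4 * C ^ 2 * (X ^ (L - 2) * b) / (1 - t * s χ) := by
      intro p hp
      rw [Finset.mem_Ico] at hp
      rw [le_div_iff₀ hpos, mul_comm]
      refine ((((hB 0 p (by omega) (by omega) (by omega)).act h hF.nonneg hF.lt_one).mul h
        hF.nonneg hF.lt_one (hB p L (by omega) (by omega) (by omega))) χ).trans (le_of_eq ?_)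
      -- Splitting at `p` lowers the total exponent by one; the product rule returns a factor `b`.
      rw [show L - 2 = (p - 0 - 1) + (L - p - 1) by omega, pow_add]
      ring
    have h3 := norm_ft_chainSource_le hμ hF.nonneg hF.lt_one w L h1 χ h2
    have h4 := h.one_sub_le_two hF.nonneg hF.lt_one χ
    calc (1 - t * s χ) * ‖ft (chainSource S s (chargedM m) t w L) χ‖
        ≤ (1 - t * s χ) * (C * X ^ (L - 2) * b +
          (L - 1 : ℕ) * (4 * C ^ 2 * (X ^ (L - 2) * b) / (1 - t * s χ))) :=
          mul_le_mul_of_nonneg_left h3 hpos.le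
      _ = (1 - t * s χ) * (C * X ^ (L - 2) * b) +
          (L - 1 : ℕ) * (4 * C ^ 2 * (X ^ (L - 2) * b)) := by
          field_simp
      _ ≤ 2 * (C * X ^ (L - 2) * b) + (L - 1 : ℕ) * (4 * C ^ 2 * (X ^ (L - 2) * b)) := by
          gcongr
      _ = _ := by ring
  rw [heq, norm_mul] at hsrc
  have hge := hF.spectral_le h (chargeAt w L) χ
  have hn := norm_nonneg (ft (subchain S s (chargedM m) t w 0 L) χ)
  have h5 : (γ * ω) * ((1 - t * s χ) * ‖ft (subchain S s (chargedM m) t w 0 L) χ‖)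
      ≤ (2 * C + 4 * (L - 1 : ℕ) * C ^ 2) * (X ^ (L - 2) * b) := by
    refine le_trans ?_ hsrc
    calc _ = (1 - t * s χ) * ((γ * ω) * ‖ft (subchain S s (chargedM m) t w 0 L) χ‖) := by ring
      _ ≤ _ := by gcongr
  have hXL : X ^ (L - 1) = X ^ (L - 2) * b / ω := by
    rw [show L - 1 = (L - 2) + 1 by omega, pow_succ, mul_div_assoc]
  rw [hXL]
  rw [← le_div_iff₀' (by positivity)] at h5
  refine h5.trans (le_of_eq ?_)
  field_simp

/-- Now the symbol is the weight `1 - t s` itself, so what must be bounded is the unweighted Fourier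
transform of `(1 - t S) M_{0L}`: directly if `r ≤ 1 - t`, by the Ward identity after division by `2
|Im m| ≥ r` otherwise. -/
theorem SubchainBound.step_ne (hF : IsFlowPoint m t r) (h : IsSymbol S s c) {C : ℝ} (hC : 0 ≤ C)
    {w : List (Bool × G)} {L : ℕ} (hL : 2 ≤ L) (hw : w.length = L + 1)
    (hB : SubchainBound S s m t r C w L) (hσ : chargeAt w 0 ≠ chargeAt w L) :
    ResolventBound s t ((2 * C + 4 * (L - 1 : ℕ) * C ^ 2) * 2 *
      (resolventDiag s t / (1 - t + r)) ^ (L - 1)) (subchain S s (chargedM m) t w 0 L) := by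
  intro χ
  have hω := hF.pos
  have hμ := norm_chargedM hF.norm_eq
  have hb := h.resolventDiag_nonneg hF.nonneg hF.lt_one
  have ht1 : 0 < 1 - t := by linarith [hF.lt_one]
  have hμ1 := chargedM_mul_of_ne hF.norm_eq hσ
  set b := resolventDiag s t
  set ω := 1 - t + r with hωdef
  set X := b / ω
  have hX : 0 ≤ X := by positivity
  set Q := X ^ (L - 2) * b with hQ
  have hQ0 : 0 ≤ Q := by positivity
  have hpos := h.one_sub_pos hF.nonneg hF.lt_one χ
  have hXL : X ^ (L - 1) = Q / ω := by
    rw [show L - 1 = (L - 2) + 1 by omega, pow_succ, mul_div_assoc]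
  have e : (1 - (t : ℂ) * s χ) = ((1 - t * s χ : ℝ) : ℂ) := by push_cast; ring
  have hfirst : ∀ x, ‖subchain S s (chargedM m) t w 1 L x‖ ≤ C * Q := fun x => by
    have := (hB 1 L (by omega) (by omega) (by omega)).norm_le h hF.nonneg hF.lt_one x
    rw [Nat.sub_sub] at this
    rwa [hQ, ← mul_assoc]
  have hlast : ∀ x, ‖subchain S s (chargedM m) t w 0 (L - 1) x‖ ≤ C * Q := fun x => by
    have := (hB 0 (L - 1) (by omega) (by omega) (by omega)).norm_le h hF.nonneg hF.lt_one x
    rw [Nat.sub_zero, Nat.sub_sub] at this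
    rwa [hQ, ← mul_assoc]
  have hXp : ∀ p, 1 ≤ p → p < L →
      C * X ^ (p - 0 - 1) * (C * X ^ (L - p - 1)) * b = C ^ 2 * Q := by
    intro p hp hp'
    rw [hQ, show L - 2 = (p - 0 - 1) + (L - p - 1) by omega, pow_add]
    ring
  have hgoal : ∀ y : ℝ, y * ω ≤ (2 * C + 4 * (L - 1 : ℕ) * C ^ 2) * 2 * Q →
      y ≤ (2 * C + 4 * (L - 1 : ℕ) * C ^ 2) * 2 * X ^ (L - 1) := by
    intro y hy
    rw [hXL, ← mul_div_assoc, le_div_iff₀ hω]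
    exact hy
  refine hgoal _ ?_
  have hr2 := hF.r_le
  have ht0 := hF.nonneg
  set k : ℝ := ((L - 1 : ℕ) : ℝ) with hk
  have hk0 : 0 ≤ k := by positivity
  set F := (1 - t * s χ) * ‖ft (subchain S s (chargedM m) t w 0 L) χ‖ with hFdef
  have hF0 : 0 ≤ F := mul_nonneg hpos.le (norm_nonneg _)
  have hCQ : 0 ≤ C * Q := by positivity
  have hkCQ : 0 ≤ k * C ^ 2 * Q := by positivity
  rcases le_or_gt r (1 - t) with hr | hr
  · have heq : ‖ft (chainSource S s (chargedM m) t w L) χ‖ = F := by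
      rw [hFdef, ← Real.norm_of_nonneg hpos.le, ← Complex.norm_real, ← norm_mul, ← e,
        ← h.ft_sub_act]
      congr 2
      funext x
      rw [← h.sub_act_eq_chainSource hμ hF.abs_lt_one w (by omega) (by omega) x, mul_assoc (t : ℂ),
        hμ1, mul_one]
    have h2 : ∀ p ∈ Finset.Ico 1 L, ‖ft (fun x => act S (subchain S s (chargedM m) t w 0 p) x *
        subchain S s (chargedM m) t w p L x) χ‖ ≤ C ^ 2 * Q / (1 - t) := by
      intro p hp
      rw [Finset.mem_Ico] at hp
      rw [← hXp p hp.1 hp.2]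
      exact ((hB 0 p (by omega) (by omega) (by omega)).act h hF.nonneg hF.lt_one).norm_ft_mul_le h
        hF.nonneg hF.lt_one (hB p L (by omega) (by omega) (by omega)) χ
    have h3 := norm_ft_chainSource_le hμ hF.nonneg hF.lt_one w L hfirst χ h2
    rw [heq] at h3
    have h4 : F * ω ≤ (C * Q) * ω + k * C ^ 2 * Q * (ω / (1 - t)) := by
      calc F * ω ≤ (C * Q + k * (C ^ 2 * Q / (1 - t))) * ω := by gcongr
        _ = _ := by ring
    -- In this regime `ω ≤ 2 (1 - t)`, which pays for the loss in the product.
    have h5 : ω / (1 - t) ≤ 2 := by rw [div_le_iff₀ ht1]; linarith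
    have h6 : ω ≤ 3 := by linarith
    have h7 := mul_le_mul_of_nonneg_left h5 hkCQ
    have h8 := mul_le_mul_of_nonneg_left h6 hCQ
    linarith
  · have heq : (2 * |m.im|) * F = ‖ft (fun x =>
        (chargedM m (chargeAt w L) - chargedM m (chargeAt w 0)) *
        (subchain S s (chargedM m) t w 0 L x - t * act S (subchain S s (chargedM m) t w 0 L) x))
        χ‖ := by
      rw [ft_const_mul, norm_mul, norm_chargedM_sub_of_ne m hσ, h.ft_sub_act, norm_mul, e,
        Complex.norm_real, Real.norm_of_nonneg hpos.le]
    have hward := funext fun x => h.ward hμ hF.abs_lt_one w (by omega : 1 ≤ L) hw hμ1 x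
    rw [hward, ft_add, ft_sub] at heq
    -- In each product the factor `(1 - t S) M` has bounded Fourier transform and the other one has
    -- Wiener norm `O(b)` times its constant, so no `1 / (1 - t)` appears.
    have h2 : ∀ p ∈ Finset.Ico 1 L, ‖ft (fun x => subchain S s (chargedM m) t w 0 p x *
          (subchain S s (chargedM m) t w p L x - t * act S (subchain S s (chargedM m) t w p L) x)
        - (subchain S s (chargedM m) t w 0 p x - t * act S (subchain S s (chargedM m) t w 0 p) x) *
          subchain S s (chargedM m) t w p L x) χ‖ ≤ 2 * (C ^ 2 * Q) := by
      intro p hp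
      rw [Finset.mem_Ico] at hp
      have b1 := hB 0 p (by omega) (by omega) (by omega)
      have b2 := hB p L (by omega) (by omega) (by omega)
      have c1 := norm_ft_mul_le_of_right (f := subchain S s (chargedM m) t w 0 p)
        (b2.norm_ft_sub_act_le h hF.nonneg hF.lt_one) χ
      have c2 := norm_ft_mul_le_of_left (g := subchain S s (chargedM m) t w p L)
        (b1.norm_ft_sub_act_le h hF.nonneg hF.lt_one) χ
      have d1 := mul_le_mul_of_nonneg_right (b1.wienerNorm_le h hF.nonneg hF.lt_one)
        (b2.nonneg h hF.nonneg hF.lt_one)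
      have d2 := mul_le_mul_of_nonneg_left (b2.wienerNorm_le h hF.nonneg hF.lt_one)
        (b1.nonneg h hF.nonneg hF.lt_one)
      have e1 := hXp p hp.1 hp.2
      rw [ft_sub]
      refine (norm_sub_le _ _).trans ?_
      linarith
    have h3 := norm_ft_sum_le _ _ χ h2
    have h4 := (norm_ft_dirac_le (siteAt w 0) (subchain S s (chargedM m) t w 1 L) χ).trans
      (hfirst _)
    have h5 := (norm_ft_dirac_le (siteAt w (L - 1))
      (subchain S s (chargedM m) t w 0 (L - 1)) χ).trans (hlast _)
    have h6 : (2 * |m.im|) * F ≤ (C * Q + C * Q) + k * (2 * (C ^ 2 * Q)) := by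
      rw [heq]
      refine (norm_add_le _ _).trans (add_le_add ((norm_sub_le _ _).trans (add_le_add h4 h5)) ?_)
      simpa using h3
    -- Here `1 - t < r ≤ 2 |Im m|`.
    have h7 : ω ≤ 2 * (2 * |m.im|) := by linarith [hF.r_le_im]
    have h8 := mul_le_mul_of_nonneg_right h7 hF0
    linarith

/-- The source is a Dirac mass. For opposite charges the symbol equals the weight. For equal charges
the two differ by at most `2 |Im m| ≤ 2 ω`, which the symbol dominates up to a constant. -/
theorem IsFlowPoint.chain_singleton (hF : IsFlowPoint m t r) (h : IsSymbol S s c)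
    (x : Bool × G) (σ : Bool) :
    ResolventBound s t (1 + 2 * (min (1 / 2) c / 4)⁻¹)
      (chain S s (chargedM m) t [x] σ) := by
  intro χ
  obtain ⟨σ₀, a₀⟩ := x
  have hμ := norm_chargedM hF.norm_eq
  have hpos := h.one_sub_pos hF.nonneg hF.lt_one χ
  have hγ : 0 < min (1 / 2) c / 4 := div_pos (lt_min (by norm_num) h.pos) (by norm_num)
  set γ := min (1 / 2) c / 4
  have hω := hF.pos
  have e : (1 - (t : ℂ) * s χ) = ((1 - t * s χ : ℝ) : ℂ) := by push_cast; ring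
  have heq : (1 - t * chargedM m σ₀ * chargedM m σ * s χ) *
      ft (chain S s (chargedM m) t [(σ₀, a₀)] σ) χ
      = ft (fun x => if a₀ = x then chargedM m σ₀ * chargedM m σ else 0) χ := by
    rw [← h.ft_sub_act]
    congr 1
    funext x
    have := h.chain_cons hμ hF.abs_lt_one σ₀ a₀ [] σ x
    simp only [chain_nil, List.length_nil, Finset.univ_eq_empty, Finset.sum_empty, zero_add] at this
    split_ifs with hx
    · rw [if_pos hx] at this; linear_combination this
    · rw [if_neg hx] at this; linear_combination this
  have hle : ‖1 - t * chargedM m σ₀ * chargedM m σ * s χ‖ *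
      ‖ft (chain S s (chargedM m) t [(σ₀, a₀)] σ) χ‖ ≤ 1 := by
    rw [← norm_mul, heq]
    refine (norm_ft_dirac_le a₀ (fun _ => chargedM m σ₀ * chargedM m σ) χ).trans ?_
    rw [norm_mul, hμ, hμ, one_mul]
  set N := ‖ft (chain S s (chargedM m) t [(σ₀, a₀)] σ) χ‖
  have hN : 0 ≤ N := norm_nonneg _
  by_cases hσ : σ₀ = σ
  · subst hσ
    have hge := hF.spectral_le h σ₀ χ
    set Z := ‖1 - t * chargedM m σ₀ * chargedM m σ₀ * s χ‖ with hZ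
    have h1 : 1 - t * s χ ≤ Z + 2 * |m.im| := by
      have h2 : (1 - t * s χ : ℂ) = (1 - t * chargedM m σ₀ * chargedM m σ₀ * s χ) +
          (t * s χ) * chargedM m σ₀ * (chargedM m σ₀ - chargedM m !σ₀) := by
        have := chargedM_mul_of_ne hF.norm_eq (σ := σ₀) (σ' := !σ₀) (by simp)
        linear_combination (t * s χ : ℂ) * this
      have h3 := norm_add_le (1 - t * chargedM m σ₀ * chargedM m σ₀ * s χ)
        ((t * s χ) * chargedM m σ₀ * (chargedM m σ₀ - chargedM m !σ₀))
      rw [← h2, e, Complex.norm_real, Real.norm_of_nonneg hpos.le, norm_mul, norm_mul, hμ,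
        norm_sub_rev (chargedM m σ₀), norm_chargedM_sub_of_ne m (σ := σ₀) (σ' := !σ₀) (by simp), mul_one, norm_mul,
        Complex.norm_real, Complex.norm_real, Real.norm_of_nonneg hF.nonneg,
        Real.norm_eq_abs] at h3
      have h4 : t * |s χ| ≤ 1 := by
        nlinarith [h.abs_le_one χ, hF.nonneg, hF.lt_one, abs_nonneg (s χ)]
      have h5 := mul_le_mul_of_nonneg_right h4 (show 0 ≤ 2 * |m.im| by positivity)
      linarith
    have h6 : 2 * |m.im| ≤ 2 * γ⁻¹ * Z := by
      have h7 : |m.im| ≤ 1 - t + r := by linarith [hF.im_le_r, hF.lt_one]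
      have h8 : 1 - t + r ≤ γ⁻¹ * Z := by
        rw [inv_mul_eq_div, le_div_iff₀ hγ, mul_comm]; exact hge
      linarith
    calc (1 - t * s χ) * N ≤ (Z + 2 * γ⁻¹ * Z) * N := by gcongr; linarith
      _ = (1 + 2 * γ⁻¹) * (Z * N) := by ring
      _ ≤ (1 + 2 * γ⁻¹) * 1 := by gcongr
      _ = _ := mul_one _
  · rw [mul_assoc (t : ℂ), chargedM_mul_of_ne hF.norm_eq hσ, mul_one, e, Complex.norm_real,
      Real.norm_of_nonneg hpos.le] at hle
    have : 0 < γ⁻¹ := inv_pos.2 hγ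
    linarith

/-- The constant in the estimate of chains of length at most `L + 1`. -/
def chainConst (c : ℝ) : ℕ → ℝ
  | 0 => 1 + 2 * (min (1 / 2) c / 4)⁻¹
  | L + 1 => stepConst c (chainConst c L) (L + 2)

theorem chainConst_nonneg (hc : 0 < c) (L : ℕ) : 0 ≤ chainConst c L := by
  have hγ : 0 < min (1 / 2) c / 4 := div_pos (lt_min (by norm_num) hc) (by norm_num)
  induction L with
  | zero => rw [chainConst]; positivity
  | succ L ih => rw [chainConst, stepConst]; positivity

/-- The estimate of the primitive loops, normalised to `W = 1`. -/
theorem IsFlowPoint.chain_bound (hF : IsFlowPoint m t r) (h : IsSymbol S s c) (L : ℕ)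
    (p : List (Bool × G)) (σ : Bool) (hp : 1 ≤ p.length) (hpL : p.length ≤ L + 1) :
    ResolventBound s t (chainConst c L * (resolventDiag s t / (1 - t + r)) ^ (p.length - 1))
      (chain S s (chargedM m) t p σ) := by
  have hγ : 0 < min (1 / 2) c / 4 := div_pos (lt_min (by norm_num) h.pos) (by norm_num)
  have hX : 0 ≤ resolventDiag s t / (1 - t + r) :=
    div_nonneg (h.resolventDiag_nonneg hF.nonneg hF.lt_one) hF.pos.le
  induction L generalizing p σ with
  | zero =>
    match p, hp, hpL with
    | [x], _, _ => simpa [chainConst] using hF.chain_singleton h x σ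
  | succ L ih =>
    have hC := chainConst_nonneg h.pos L
    rw [chainConst, stepConst]
    set C := chainConst c L
    have hD : 0 ≤ 2 * C + 4 * ((L + 2 - 1 : ℕ) : ℝ) * C ^ 2 := by positivity
    rcases Nat.lt_or_ge p.length (L + 2) with hlt | hge
    · refine (ih p σ hp (by omega)).mono ?_
      gcongr
      have : 0 ≤ (2 * C + 4 * ((L + 2 - 1 : ℕ) : ℝ) * C ^ 2) * ((min (1 / 2) c / 4)⁻¹ + 2) := by
        positivity
      linarith
    · have hpl : p.length = L + 2 := by omega
      -- The site `0` of the appended letter is a dummy: the last site is the free variable of a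
      -- chain.
      rw [← subchain_append (chargedM m) p σ 0, hpl]
      have hw : (p ++ [(σ, (0 : G))]).length = L + 2 + 1 := by simp [hpl]
      have hB : SubchainBound S s m t r C (p ++ [(σ, (0 : G))]) (L + 2) := by
        intro i j hij hj hL
        obtain ⟨q, τ, hq, he⟩ := exists_subchain_eq_chain (S := S) (s := s) (t := t)
          (chargedM m) hij.le hj
        rw [he, ← hq]
        exact ih q τ (by omega) (by omega)
      have hD' : 0 ≤ (2 * C + 4 * ((L + 2 - 1 : ℕ) : ℝ) * C ^ 2) * (min (1 / 2) c / 4)⁻¹ := by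
        positivity
      by_cases hσ : chargeAt (p ++ [(σ, (0 : G))]) 0 = chargeAt (p ++ [(σ, (0 : G))]) (L + 2)
      · refine (hB.step_same hF h hC (by omega) hw hσ).mono ?_
        gcongr
        linarith
      · refine (hB.step_ne hF h hC (by omega) hw hσ).mono ?_
        gcongr
        linarith

theorem IsFlowPoint.norm_chain_le (hF : IsFlowPoint m t r) (h : IsSymbol S s c)
    (p : List (Bool × G)) (σ : Bool) (hp : 1 ≤ p.length) (x : G) :
    ‖chain S s (chargedM m) t p σ x‖ ≤ chainConst c (p.length - 1) *
      (resolventDiag s t / (1 - t + r)) ^ (p.length - 1) * resolventDiag s t :=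
  (hF.chain_bound h (p.length - 1) p σ hp (by omega)).norm_le h hF.nonneg hF.lt_one x

end Bounds

/-! ### From chains to primitive loops: existence and uniqueness -/

section Cuts

variable {d n : ℕ}

theorem cutLeft_eq_cutWord (w : LoopIndex d n) (k l : Fin w.length) (a : BlockTorus d n) :
    cutLeft w k l a = cutWord w k l a := by
  simp [cutLeft, cutWord, chargeAt]

theorem cutRight_eq (w : LoopIndex d n) (k l : Fin w.length) (b : BlockTorus d n) :
    cutRight w k l b = (w.take l).drop k ++ [(chargeAt w l, b)] := by
  simp [cutRight, chargeAt]

end Cuts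

section Family

variable {d n : ℕ} [NeZero n] {W : ℕ} {lam c t : ℝ} {m : ℂ}
variable {s : AddChar (BlockTorus d n) ℂ → ℝ}

/-- The primitive loops, expressed through chains. -/
def loopFamily (d n : ℕ) [NeZero n] (W : ℕ) (lam : ℝ) (s : AddChar (BlockTorus d n) ℂ → ℝ) (m : ℂ)
    (t : ℝ) (w : LoopIndex d n) : ℂ :=
  (((W : ℂ) ^ d)⁻¹) ^ (w.length - 1) *
    subchain (blockVariance d n lam) s (chargedM m) t w 0 (w.length - 1) (siteAt w (w.length - 1))

theorem loopFamily_append (p : LoopIndex d n) (σ : Bool) (x : BlockTorus d n) :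
    loopFamily d n W lam s m t (p ++ [(σ, x)])
      = (((W : ℂ) ^ d)⁻¹) ^ p.length * chain (blockVariance d n lam) s (chargedM m) t p σ x := by
  have h1 : (p ++ [(σ, x)]).length - 1 = p.length := by simp
  have h2 : siteAt (p ++ [(σ, x)]) p.length = x := by simp [siteAt]
  rw [loopFamily, h1, h2, subchain_append]

theorem IsSymbol.chain_zero {G : Type*} [AddCommGroup G] [Fintype G] [DecidableEq G]
    {S : Matrix G G ℝ} {s : AddChar G ℂ → ℝ} (h : IsSymbol S s c) {μ : Bool → ℂ}
    (hμ : ∀ σ, ‖μ σ‖ = 1) (p : List (Bool × G)) (σ : Bool) (x : G) :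
    chain S s μ 0 p σ x = if ∀ y ∈ p, y.2 = x then (p.map fun y => μ y.1).prod * μ σ else 0 := by
  induction p with
  | nil => simp [chain_nil]
  | cons y q ih =>
    obtain ⟨σ₀, a₀⟩ := y
    rw [h.chain_cons hμ (by simp), ih]
    by_cases ha : a₀ = x <;> simp [ha, mul_assoc]

theorem mLoop_append (p : LoopIndex d n) (σ : Bool) (x : BlockTorus d n) :
    mLoop W m (p ++ [(σ, x)]) = (((W : ℂ) ^ d)⁻¹) ^ p.length *
      if ∀ y ∈ p, y.2 = x then (p.map fun y => chargedM m y.1).prod * chargedM m σ else 0 := by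
  have h : (∀ y ∈ p ++ [(σ, x)], ∀ z ∈ p ++ [(σ, x)], y.2 = z.2) ↔ ∀ y ∈ p, y.2 = x := by
    constructor
    · intro h y hy
      exact h y (by simp [hy]) (σ, x) (by simp)
    · intro h y hy z hz
      have key : ∀ y ∈ p ++ [(σ, x)], y.2 = x := by
        intro y hy
        rcases List.mem_append.1 hy with hy | hy
        · exact h y hy
        · simp at hy; rw [hy]
      rw [key y hy, key z hz]
  rw [mLoop]
  simp only [h]
  split_ifs <;> simp

theorem sum_fin_filter_lt {M : Type*} [AddCommMonoid M] (N : ℕ) (f : ℕ → ℕ → M) :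
    ∑ k : Fin N, ∑ l ∈ Finset.univ.filter (fun l => k < l), f k l
      = ∑ k ∈ Finset.range N, ∑ l ∈ Finset.Ioo k N, f k l := by
  rw [← Fin.sum_univ_eq_sum_range (fun k => ∑ l ∈ Finset.Ioo k N, f k l)]
  refine Finset.sum_congr rfl fun k _ => ?_
  have h : ∑ l ∈ Finset.univ.filter (fun l => k < l), f k l
      = ∑ l : Fin N, if (k : ℕ) < l then f k l else 0 := Finset.sum_filter _ _
  rw [h, Fin.sum_univ_eq_sum_range (fun l => if (k : ℕ) < l then f k l else 0),
    ← Finset.sum_filter]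
  congr 1
  ext l
  simp [and_comm]

/-- The sum over `b` is the action of `S` on the right cut. The two cuts have total length two more
than the number of powers `W ^ (-d)` they carry, which is the length of `w`; the prefactor `W ^ d`
removes one power. -/
theorem primitiveRHS_loopFamily (hW : W ≠ 0) (w : LoopIndex d n) (hw : 2 ≤ w.length) :
    primitiveRHS W lam (loopFamily d n W lam s m t) w
      = (((W : ℂ) ^ d)⁻¹) ^ (w.length - 1) *
        primitiveSum (blockVariance d n lam) s (chargedM m) t w 0 (w.length - 1)
          (siteAt w (w.length - 1)) := by
  have hWd : (W : ℂ) ^ d ≠ 0 := pow_ne_zero _ (by exact_mod_cast hW)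
  have hterm : ∀ k l : Fin w.length, k < l →
      ∑ a : BlockTorus d n, ∑ b : BlockTorus d n,
        loopFamily d n W lam s m t (cutLeft w k l a) * (blockVariance d n lam a b : ℂ) *
          loopFamily d n W lam s m t (cutRight w k l b)
      = (((W : ℂ) ^ d)⁻¹) ^ w.length * ∑ a : BlockTorus d n,
          act (blockVariance d n lam) (subchain (blockVariance d n lam) s (chargedM m) t w k l) a *
          cutSubchain (blockVariance d n lam) s (chargedM m) t w k l a 0 (w.length - 1)
            (siteAt w (w.length - 1)) := by
    intro k l hkl
    have hkl' : (k : ℕ) < l := hkl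
    have hl := l.2
    rw [Finset.mul_sum]
    refine Finset.sum_congr rfl fun a _ => ?_
    have hL : loopFamily d n W lam s m t (cutLeft w k l a)
        = (((W : ℂ) ^ d)⁻¹) ^ (w.length - l + k) *
          cutSubchain (blockVariance d n lam) s (chargedM m) t w k l a 0 (w.length - 1)
            (siteAt w (w.length - 1)) := by
      have e1 : (cutWord w k l a).length - 1 = w.length - l + k := by
        rw [cutWord_length a k.2]; omega
      have e2 : (cutWord w k l a).length - 1 = w.length - 1 + (k + 1) - l := by
        rw [cutWord_length a k.2]; omega
      rw [cutLeft_eq_cutWord, loopFamily, cutSubchain_of (by omega) (by omega), e2,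
        siteAt_cutWord_gt a k.2 (by omega), ← e2, e1]
    have hR : ∀ b, loopFamily d n W lam s m t (cutRight w k l b)
        = (((W : ℂ) ^ d)⁻¹) ^ (l - k : ℕ) *
          subchain (blockVariance d n lam) s (chargedM m) t w k l b := by
      intro b
      rw [cutRight_eq, loopFamily_append, subchain, if_pos hkl'.le]
      congr 2
      simp
    rw [act, Finset.sum_mul, Finset.mul_sum]
    refine Finset.sum_congr rfl fun b _ => ?_
    have hp : (((W : ℂ) ^ d)⁻¹) ^ w.length
        = (((W : ℂ) ^ d)⁻¹) ^ (w.length - l + k) * (((W : ℂ) ^ d)⁻¹) ^ (l - k : ℕ) := by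
      rw [← pow_add]; congr 1; omega
    rw [hL, hR, hp]
    ring
  rw [primitiveRHS, primitiveSum, ← sum_fin_filter_lt w.length (fun k l => ∑ a : BlockTorus d n,
          act (blockVariance d n lam) (subchain (blockVariance d n lam) s (chargedM m) t w k l) a *
          cutSubchain (blockVariance d n lam) s (chargedM m) t w k l a 0 (w.length - 1)
            (siteAt w (w.length - 1)))]
  have hp : (((W : ℂ) ^ d)⁻¹) ^ (w.length - 1)
      = (W : ℂ) ^ d * (((W : ℂ) ^ d)⁻¹) ^ w.length := by
    obtain ⟨N, hN⟩ : ∃ N, w.length = N + 1 := ⟨w.length - 1, by omega⟩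
    rw [hN, Nat.add_sub_cancel, pow_succ]
    field_simp
  rw [hp, mul_assoc]
  congr 1
  rw [Finset.mul_sum]
  refine Finset.sum_congr rfl fun k _ => ?_
  rw [Finset.mul_sum]
  refine Finset.sum_congr rfl fun l hl => ?_
  exact hterm k l (Finset.mem_filter.1 hl).2

theorem isPrimitiveLoopFamily_loopFamily (hW : W ≠ 0) (h : IsSymbol (blockVariance d n lam) s c)
    (hm : ‖m‖ = 1) : IsPrimitiveLoopFamily W lam m (loopFamily d n W lam s m) where
  one_loop t _ σ a := by
    have := loopFamily_append (W := W) (lam := lam) (s := s) (m := m) (t := t) [] σ a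
    simpa [chain_nil] using this
  initial w hw := by
    obtain ⟨p, x, rfl⟩ := List.eq_nil_or_concat w |>.resolve_left (by rintro rfl; simp at hw)
    obtain ⟨σ, x⟩ := x
    rw [List.concat_eq_append, loopFamily_append, mLoop_append, h.chain_zero (norm_chargedM hm)]
  equation w hw t ht := by
    have ht' : |t| < 1 := by rw [abs_of_nonneg ht.1]; exact ht.2
    rw [primitiveRHS_loopFamily hW w hw]
    exact ((h.hasDerivAt_subchain (norm_chargedM hm) ht' w (Nat.zero_le _) (by omega)
      _).const_mul _).hasDerivWithinAt

/-- A local Lipschitz constant of the right-hand side of the primitive equation. -/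
def primitiveLipschitz (W : ℕ) (lam : ℝ) (B' B : LoopIndex d n → ℝ) (w : LoopIndex d n) : ℝ :=
  ‖(W : ℂ) ^ d‖ * ∑ k : Fin w.length, ∑ l ∈ Finset.univ.filter (fun l => k < l),
    ∑ a : BlockTorus d n, ∑ b : BlockTorus d n,
      ‖(blockVariance d n lam a b : ℂ)‖ * (|B' (cutLeft w k l a)| + |B (cutRight w k l b)|)

theorem primitiveLipschitz_nonneg (W : ℕ) (lam : ℝ) (B' B : LoopIndex d n → ℝ)
    (w : LoopIndex d n) : 0 ≤ primitiveLipschitz W lam B' B w := by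
  unfold primitiveLipschitz; positivity

/-- The right-hand side is quadratic, so `F'G' - FG = F'(G' - G) + (F' - F)G` gives a local
Lipschitz bound. -/
theorem norm_primitiveRHS_sub_le {F F' : LoopIndex d n → ℂ} {B B' : LoopIndex d n → ℝ} {δ : ℝ}
    (w : LoopIndex d n) (hB' : ∀ u, u ≠ [] → ‖F' u‖ ≤ B' u) (hB : ∀ u, u ≠ [] → ‖F u‖ ≤ B u)
    (hδ : ∀ u, u ≠ [] → u.length ≤ w.length → ‖F' u - F u‖ ≤ δ) :
    ‖primitiveRHS W lam F' w - primitiveRHS W lam F w‖ ≤ primitiveLipschitz W lam B' B w * δ := by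
  have e : primitiveRHS W lam F' w - primitiveRHS W lam F w = (W : ℂ) ^ d *
      ∑ k : Fin w.length, ∑ l ∈ Finset.univ.filter (fun l => k < l),
      ∑ a : BlockTorus d n, ∑ b : BlockTorus d n, (blockVariance d n lam a b : ℂ) *
      (F' (cutLeft w k l a) * (F' (cutRight w k l b) - F (cutRight w k l b)) +
      (F' (cutLeft w k l a) - F (cutLeft w k l a)) * F (cutRight w k l b)) := by
    rw [primitiveRHS, primitiveRHS, ← mul_sub, ← Finset.sum_sub_distrib]
    congr 1
    refine Finset.sum_congr rfl fun k _ => ?_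
    rw [← Finset.sum_sub_distrib]
    refine Finset.sum_congr rfl fun l _ => ?_
    rw [← Finset.sum_sub_distrib]
    refine Finset.sum_congr rfl fun a _ => ?_
    rw [← Finset.sum_sub_distrib]
    refine Finset.sum_congr rfl fun b _ => ?_
    ring
  rw [e, norm_mul]
  rw [primitiveLipschitz, mul_assoc]
  refine mul_le_mul_of_nonneg_left ?_ (norm_nonneg _)
  rw [Finset.sum_mul]
  refine (norm_sum_le _ _).trans (Finset.sum_le_sum fun k _ => ?_)
  rw [Finset.sum_mul]
  refine (norm_sum_le _ _).trans (Finset.sum_le_sum fun l hl => ?_)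
  rw [Finset.sum_mul]
  refine (norm_sum_le _ _).trans (Finset.sum_le_sum fun a _ => ?_)
  rw [Finset.sum_mul]
  refine (norm_sum_le _ _).trans (Finset.sum_le_sum fun b _ => ?_)
  rw [norm_mul, mul_assoc]
  refine mul_le_mul_of_nonneg_left ?_ (norm_nonneg _)
  have hkl : (k : ℕ) < l := (Finset.mem_filter.1 hl).2
  have hl2 := l.2
  have n1 : cutLeft w k l a ≠ [] := by simp [cutLeft]
  have n2 : cutRight w k l b ≠ [] := by simp [cutRight]
  have l1 : (cutLeft w k l a).length ≤ w.length := by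
    rw [cutLeft_eq_cutWord, cutWord_length a k.2]; omega
  have l2 : (cutRight w k l b).length ≤ w.length := by
    simp [cutRight]; omega
  have b1 := (hB' _ n1).trans (le_abs_self _)
  have b2 := (hB _ n2).trans (le_abs_self _)
  have d1 := hδ _ n1 l1
  have d2 := hδ _ n2 l2
  refine (norm_add_le _ _).trans ?_
  rw [norm_mul, norm_mul, add_mul, mul_comm ‖F' (cutLeft w k l a) - _‖]
  gcongr

/-- Cuts have at most the length of the loop, and shorter loops agree by induction. The differences
at length `N + 1` therefore form a closed finite system with linear growth and zero initial value.
-/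
theorem IsPrimitiveLoopFamily.eq {K K' : ℝ → LoopIndex d n → ℂ}
    (hK : IsPrimitiveLoopFamily W lam m K) (hK' : IsPrimitiveLoopFamily W lam m K')
    (N : ℕ) : ∀ t ∈ Set.Ico (0 : ℝ) 1, ∀ w : LoopIndex d n, w ≠ [] → w.length ≤ N →
      K' t w = K t w := by
  induction N with
  | zero => intro t _ w hw hN; simp at hN; exact absurd hN hw
  | succ N ih =>
    intro T hT w hw hN
    rcases Nat.lt_or_ge w.length 2 with h1 | h2
    · match w, hw with
      | [(σ, a)], _ => rw [hK.one_loop T hT, hK'.one_loop T hT]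
      | _ :: _ :: _, _ => simp at h1
    rcases Nat.lt_or_ge N w.length with hlt | hle
    swap
    · exact ih T hT w hw hle
    have hwN : w.length = N + 1 := by omega
    have hN1 : 2 ≤ N + 1 := by omega
    -- Compactness of `[0, T]` with `T < 1` provides the bounds on both families.
    have hsub : Set.Icc 0 T ⊆ Set.Ico (0 : ℝ) 1 := fun x hx => ⟨hx.1, hx.2.trans_lt hT.2⟩
    have hcont : ∀ F : ℝ → LoopIndex d n → ℂ, IsPrimitiveLoopFamily W lam m F → ∀ u, u ≠ [] →
        ContinuousOn (fun x => F x u) (Set.Icc 0 T) := by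
      intro F hF u hu
      rcases Nat.lt_or_ge u.length 2 with h1 | h2
      · match u, hu with
        | [(σ, a)], _ =>
          exact continuousOn_const.congr fun x hx => hF.one_loop x (hsub hx) σ a
        | _ :: _ :: _, _ => simp at h1
      · exact fun x hx => ((hF.equation u h2 x (hsub hx)).continuousWithinAt).mono hsub
    have hbdd : ∀ F : ℝ → LoopIndex d n → ℂ, IsPrimitiveLoopFamily W lam m F → ∀ u, ∃ C, u ≠ [] →
        ∀ x ∈ Set.Icc 0 T, ‖F x u‖ ≤ C := by
      intro F hF u
      by_cases hu : u = []
      · exact ⟨0, fun h => absurd hu h⟩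
      · obtain ⟨C, hC⟩ := isCompact_Icc.exists_bound_of_continuousOn (hcont F hF u hu)
        exact ⟨C, fun _ => hC⟩
    choose B hB using hbdd K hK
    choose B' hB' using hbdd K' hK'
    -- All words of length `N + 1` at once: a cut can have full length, so single words do not give
    -- closed equations.
    let D : ℝ → List.Vector (Bool × BlockTorus d n) (N + 1) → ℂ := fun x v => K' x v.1 - K x v.1
    let D' : ℝ → List.Vector (Bool × BlockTorus d n) (N + 1) → ℂ := fun x v =>
      primitiveRHS W lam (K' x) v.1 - primitiveRHS W lam (K x) v.1
    have hDu : ∀ x ∈ Set.Icc 0 T, ∀ u : LoopIndex d n, u ≠ [] → u.length ≤ N + 1 →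
        ‖K' x u - K x u‖ ≤ ‖D x‖ := by
      intro x hx u hu hul
      rcases Nat.lt_or_ge N u.length with h3 | h3
      · exact norm_le_pi_norm (D x) ⟨u, by omega⟩
      · rw [ih x (hsub hx) u hu h3, sub_self, norm_zero]
        exact norm_nonneg _
    let M : List.Vector (Bool × BlockTorus d n) (N + 1) → ℝ := fun v =>
      primitiveLipschitz W lam B' B v.1
    have hM0 : ∀ v, 0 ≤ M v := fun v => primitiveLipschitz_nonneg _ _ _ _ _
    have hD' : ∀ x ∈ Set.Icc 0 T, ∀ v, ‖D' x v‖ ≤ M v * ‖D x‖ := fun x hx v =>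
      norm_primitiveRHS_sub_le v.1 (fun u hu => hB' u hu x hx) (fun u hu => hB u hu x hx)
        (fun u hu hul => hDu x hx u hu (hul.trans v.2.le))
    have hzero := eq_zero_of_abs_deriv_le_mul_abs_self_of_eq_zero_right (f := D) (f' := D')
      (K := ∑ v, M v) (a := 0) (b := T) ?_ ?_ ?_ ?_ T ⟨hT.1, le_rfl⟩
    · exact sub_eq_zero.1 (congrFun hzero ⟨w, hwN⟩)
    · refine continuousOn_pi.2 fun v => ?_
      have hv : v.1 ≠ [] := by
        have := v.2
        intro h0
        rw [h0] at this
        simp at this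
      exact (hcont K' hK' v.1 hv).sub (hcont K hK v.1 hv)
    · intro x hx
      refine hasDerivWithinAt_pi.2 fun v => ?_
      have hv : 2 ≤ v.1.length := by rw [v.2]; exact hN1
      have hx1 : x ∈ Set.Ico (0 : ℝ) 1 := ⟨hx.1, hx.2.trans hT.2⟩
      have := (hK'.equation v.1 hv x hx1).sub (hK.equation v.1 hv x hx1)
      refine this.mono_of_mem_nhdsWithin ?_
      exact Ico_mem_nhdsGE_of_mem hx1
    · funext v
      have hv : 2 ≤ v.1.length := by rw [v.2]; exact hN1
      simp [D, hK'.initial v.1 hv, hK.initial v.1 hv]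
    · intro x hx
      have hx' : x ∈ Set.Icc 0 T := ⟨hx.1, hx.2.le⟩
      rw [pi_norm_le_iff_of_nonneg
        (mul_nonneg (Finset.sum_nonneg fun v _ => hM0 v) (norm_nonneg _))]
      intro v
      refine (hD' x hx' v).trans (mul_le_mul_of_nonneg_right ?_ (norm_nonneg _))
      exact Finset.single_le_sum (fun v _ => hM0 v) (Finset.mem_univ v)

end Family

/-! ### The Fourier symbol of the block variance -/

section Variance

variable {d n : ℕ} {lam : ℝ}

theorem blockVariance_apply (x y : BlockTorus d n) :
    blockVariance d n lam x y = (1 + 2 * (d : ℝ) * lam ^ 2)⁻¹ * ((if y = x then 1 else 0) +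
      lam ^ 2 * ∑ i : Fin d, ((if y = x + Pi.single i 1 then 1 else 0) +
        (if y = x - Pi.single i 1 then 1 else 0))) := by
  simp only [blockVariance, blockLaplacian, Matrix.smul_apply, Matrix.add_apply, Matrix.sub_apply,
    Matrix.one_apply, Matrix.of_apply, smul_eq_mul, Finset.sum_sub_distrib, Finset.sum_const,
    Finset.card_univ, Fintype.card_fin, nsmul_eq_mul, Finset.sum_add_distrib, eq_comm (a := x)]
  ring

/-- The Fourier multiplier of the block variance. -/
def blockSymbol (d n : ℕ) (lam : ℝ) (χ : AddChar (BlockTorus d n) ℂ) : ℝ :=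
  (1 + 2 * (d : ℝ) * lam ^ 2)⁻¹ * (1 + 2 * lam ^ 2 * ∑ i : Fin d, (χ (Pi.single i 1)).re)

theorem one_sub_blockSymbol (χ : AddChar (BlockTorus d n) ℂ) :
    1 - blockSymbol d n lam χ = 2 * lam ^ 2 * (1 + 2 * (d : ℝ) * lam ^ 2)⁻¹ *
      ∑ i : Fin d, (1 - (χ (Pi.single i 1)).re) := by
  have h : (1 + 2 * (d : ℝ) * lam ^ 2) ≠ 0 := by positivity
  simp only [blockSymbol, Finset.sum_sub_distrib, Finset.sum_const, Finset.card_univ,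
    Fintype.card_fin, nsmul_eq_mul, mul_one]
  field_simp
  ring

variable [NeZero n]

theorem act_blockVariance (f : BlockTorus d n → ℂ) (x : BlockTorus d n) :
    act (blockVariance d n lam) f x = (1 + 2 * (d : ℂ) * lam ^ 2)⁻¹ * (f x +
      lam ^ 2 * ∑ i : Fin d, (f (x + Pi.single i 1) + f (x - Pi.single i 1))) := by
  have h : ∀ y, ((blockVariance d n lam x y : ℝ) : ℂ) * f y
      = (1 + 2 * (d : ℂ) * lam ^ 2)⁻¹ * ((if y = x then f y else 0) +
      lam ^ 2 * ∑ i : Fin d, ((if y = x + Pi.single i 1 then f y else 0) +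
        (if y = x - Pi.single i 1 then f y else 0))) := by
    intro y
    rw [blockVariance_apply]
    push_cast
    rw [show ∀ q a l b g : ℂ, q * (a + l * b) * g = q * (a * g + l * (b * g)) from
      fun _ _ _ _ _ => by ring, Finset.sum_mul]
    congr 2
    · split_ifs <;> simp
    · refine congrArg _ (Finset.sum_congr rfl fun i _ => ?_)
      split_ifs <;> simp
      ring
  rw [act, Finset.sum_congr rfl fun y _ => h y, ← Finset.mul_sum, Finset.sum_add_distrib,
    ← Finset.mul_sum, Finset.sum_comm]
  simp [Finset.sum_add_distrib]

theorem ft_shift {G : Type*} [AddCommGroup G] [Fintype G] (f : G → ℂ) (e : G)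
    (χ : AddChar G ℂ) : ft (fun x => f (x + e)) χ = χ e * ft f χ := by
  rw [ft, ft, Finset.mul_sum, ← Equiv.sum_comp (Equiv.addRight e)
    (fun x => χ e * (f x * χ (-x)))]
  refine Finset.sum_congr rfl fun x _ => ?_
  rw [Equiv.coe_addRight, neg_add, AddChar.map_add_eq_mul, mul_left_comm (χ e), mul_left_comm (χ e),
    ← AddChar.map_add_eq_mul, add_neg_cancel, AddChar.map_zero_eq_one, mul_one]

/-- On the unit circle `1 - Re u = |1 - u|² / 2`, and `|1 - u v| ≤ |1 - u| + |1 - v|`. -/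
theorem re_mul_ge {u v : ℂ} (hu : ‖u‖ = 1) (hv : ‖v‖ = 1) :
    1 - (u * v).re ≤ 2 * (1 - u.re) + 2 * (1 - v.re) := by
  have h1 : u.re ^ 2 + u.im ^ 2 = 1 := by
    have := Complex.sq_norm u
    rw [hu, Complex.normSq_apply] at this
    linarith
  have h2 : v.re ^ 2 + v.im ^ 2 = 1 := by
    have := Complex.sq_norm v
    rw [hv, Complex.normSq_apply] at this
    linarith
  rw [Complex.mul_re]
  nlinarith [sq_nonneg (u.im + v.im), sq_nonneg (u.re + v.re - 2), sq_nonneg (u.im - v.im),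
    sq_nonneg (u.re - v.re)]

theorem isSymbol_blockVariance {C : ℝ} (hlam : 0 < lam) (hC : lam ≤ C) :
    IsSymbol (blockVariance d n lam) (blockSymbol d n lam) (2 / (1 + 2 * (d : ℝ) * C ^ 2)) where
  ft_act f χ := by
    have e : act (blockVariance d n lam) f = fun x => (1 + 2 * (d : ℂ) * lam ^ 2)⁻¹ * (f x +
      lam ^ 2 * ∑ i : Fin d, (f (x + Pi.single i 1) + f (x + -Pi.single i 1))) := by
      funext x; rw [act_blockVariance]; simp only [sub_eq_add_neg]
    have h2 : ∀ i : Fin d, χ (Pi.single i 1) + χ (-Pi.single i 1)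
        = 2 * ((χ (Pi.single i 1)).re : ℂ) := by
      intro i
      rw [AddChar.map_neg_eq_conj, Complex.add_conj]
      push_cast; ring
    rw [e, ft_const_mul, ft_add, ft_const_mul, ft_sum]
    simp only [ft_add, ft_shift]
    simp only [← add_mul, h2, ← Finset.sum_mul, ← Finset.mul_sum, blockSymbol]
    push_cast
    ring
  act_const a x := by
    rw [act_blockVariance]
    have h : (1 + 2 * (d : ℂ) * lam ^ 2) ≠ 0 := by
      have : (1 + 2 * (d : ℝ) * lam ^ 2) ≠ 0 := by positivity
      exact_mod_cast this
    simp only [Finset.sum_const, Finset.card_univ, Fintype.card_fin, nsmul_eq_mul]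
    field_simp
    ring
  le_one χ := by
    rw [← sub_nonneg, one_sub_blockSymbol]
    refine mul_nonneg (by positivity) (Finset.sum_nonneg fun i _ => ?_)
    have := (Complex.re_le_norm (χ (Pi.single i 1)))
    rw [AddChar.norm_apply] at this
    linarith
  lower χ := by
    have h1 : 1 - blockSymbol d n lam χ ≤ 2 * lam ^ 2 * (1 + 2 * (d : ℝ) * lam ^ 2)⁻¹ * (d * 2) := by
      rw [one_sub_blockSymbol]
      refine mul_le_mul_of_nonneg_left ?_ (by positivity)
      have : ∑ i : Fin d, (1 - (χ (Pi.single i 1)).re) ≤ ∑ i : Fin d, (2 : ℝ) := by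
        refine Finset.sum_le_sum fun i _ => ?_
        have := (abs_le.1 (Complex.abs_re_le_norm (χ (Pi.single i 1)))).1
        rw [AddChar.norm_apply] at this
        linarith
      simpa using this
    have hp : 0 < 1 + 2 * (d : ℝ) * lam ^ 2 := by positivity
    have h2 : 2 / (1 + 2 * (d : ℝ) * C ^ 2) ≤ 2 / (1 + 2 * (d : ℝ) * lam ^ 2) := by
      gcongr
    -- Source of the gap constant: the lowest conceivable symbol is `-1 + 2 / (1 + 2 d λ²)`, and `λ
    -- ≤ C`.
    have h3 : 2 * lam ^ 2 * (1 + 2 * (d : ℝ) * lam ^ 2)⁻¹ * (d * 2)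
        = 2 - 2 / (1 + 2 * (d : ℝ) * lam ^ 2) := by
      field_simp; ring
    linarith
  pos := by positivity
  subadd χ ψ := by
    rw [one_sub_blockSymbol, one_sub_blockSymbol, one_sub_blockSymbol]
    have h : ∑ i : Fin d, (1 - ((χ + ψ) (Pi.single i 1)).re)
        ≤ 2 * ∑ i : Fin d, (1 - (χ (Pi.single i 1)).re) +
          2 * ∑ i : Fin d, (1 - (ψ (Pi.single i 1)).re) := by
      rw [Finset.mul_sum, Finset.mul_sum, ← Finset.sum_add_distrib]
      refine Finset.sum_le_sum fun i _ => ?_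
      rw [AddChar.add_apply]
      exact re_mul_ge (AddChar.norm_apply _ _) (AddChar.norm_apply _ _)
    have hq : 0 ≤ 2 * lam ^ 2 * (1 + 2 * (d : ℝ) * lam ^ 2)⁻¹ := by positivity
    have := mul_le_mul_of_nonneg_left h hq
    linarith

end Variance

/-! ### Characters of the torus and harmonic sums -/

section Characters

variable {d n : ℕ} [NeZero n]

/-- The frequencies of a character of the block torus. -/
def frequency (χ : AddChar (BlockTorus d n) ℂ) (i : Fin d) : ZMod n :=
  AddChar.zmodAddEquiv.symm (χ.compAddMonoidHom (AddMonoidHom.single (fun _ => ZMod n) i))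

theorem zmodAddEquiv_frequency (χ : AddChar (BlockTorus d n) ℂ) (i : Fin d) (a : ZMod n) :
    AddChar.zmodAddEquiv (frequency χ i) a = χ (Pi.single i a) := by
  rw [frequency, AddEquiv.apply_symm_apply]
  rfl

/-- A character is determined by its restrictions to the coordinate axes, and the dual group has the
cardinality of the group. -/
theorem frequency_bijective :
    Function.Bijective (frequency : AddChar (BlockTorus d n) ℂ → Fin d → ZMod n) := by
  rw [Fintype.bijective_iff_injective_and_card]
  refine ⟨fun χ ψ h => ?_, AddChar.card_eq⟩
  ext x
  rw [← Finset.univ_sum_single x]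
  induction (Finset.univ : Finset (Fin d)) using Finset.induction_on with
  | empty => simp
  | insert i s hi ih =>
    rw [Finset.sum_insert hi, AddChar.map_add_eq_mul, AddChar.map_add_eq_mul, ih,
      ← zmodAddEquiv_frequency, ← zmodAddEquiv_frequency, h]

/-- `1 - cos(2πk/n) = 2 sin²(πk/n)`, and `|sin y| ≥ 2 |y| / π` for `|y| ≤ π / 2`; the representative
`k` of least absolute value stays in this range. -/
theorem one_sub_re_frequency (χ : AddChar (BlockTorus d n) ℂ) (i : Fin d) :
    8 * ((frequency χ i).valMinAbs.natAbs / n : ℝ) ^ 2 ≤ 1 - (χ (Pi.single i 1)).re := by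
  set k := frequency χ i with hk
  have hn : (0 : ℝ) < n := Nat.cast_pos.2 (NeZero.pos n)
  have h1 : (χ (Pi.single i 1)).re = Real.cos (2 * (Real.pi * (k.valMinAbs / n))) := by
    rw [← zmodAddEquiv_frequency, ← hk, AddChar.zmodAddEquiv_apply]
    have h2 := AddChar.zmod_intCast n k.valMinAbs 1
    rw [ZMod.coe_valMinAbs, Int.cast_one] at h2
    change ((AddChar.zmod n k 1 : Circle) : ℂ).re = _
    rw [h2, Circle.coe_exp, Complex.exp_ofReal_mul_I_re]
    congr 1
    push_cast
    ring
  have hle : (|(k.valMinAbs : ℝ) / n|) ≤ 1 / 2 := by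
    have := ZMod.natAbs_valMinAbs_le k
    have h3 : (k.valMinAbs.natAbs : ℝ) ≤ n / 2 := by
      calc (k.valMinAbs.natAbs : ℝ) ≤ ((n / 2 : ℕ) : ℝ) := by exact_mod_cast this
        _ ≤ _ := Nat.cast_div_le
    rw [abs_div, abs_of_pos hn, div_le_iff₀ hn, ← Int.cast_abs, ← Nat.cast_natAbs]
    linarith
  have hs := Real.mul_abs_le_abs_sin (x := Real.pi * (k.valMinAbs / n)) (by
    rw [abs_mul, abs_of_pos Real.pi_pos]
    nlinarith [Real.pi_pos])
  rw [abs_mul, abs_of_pos Real.pi_pos, ← mul_assoc, div_mul_cancel₀ _ Real.pi_ne_zero] at hs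
  have hab : (k.valMinAbs.natAbs / n : ℝ) = |(k.valMinAbs : ℝ) / n| := by
    rw [abs_div, abs_of_pos hn, ← Int.cast_abs, ← Nat.cast_natAbs]
  rw [h1, hab, Real.cos_two_mul, Real.cos_sq']
  have h5 := pow_le_pow_left₀ (by positivity) hs 2
  rw [sq_abs (Real.sin _)] at h5
  nlinarith

/-- The weight `1 / |k|`, with the value `1` at `k = 0`. -/
def invAbs {n : ℕ} (k : ZMod n) : ℝ := if k = 0 then 1 else (k.valMinAbs.natAbs : ℝ)⁻¹

theorem invAbs_nonneg {n : ℕ} (k : ZMod n) : 0 ≤ invAbs k := by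
  unfold invAbs; split_ifs <;> positivity

theorem sum_inv_range_le (N : ℕ) : ∑ i ∈ Finset.range N, ((i : ℝ))⁻¹ ≤ 1 + Real.log N := by
  have h := harmonic_le_one_add_log N
  refine le_trans ?_ h
  rw [harmonic]
  push_cast
  rcases N with _ | N
  · simp
  · rw [Finset.sum_range_succ', Finset.sum_range_succ]
    have : (0 : ℝ) ≤ ((N : ℝ) + 1)⁻¹ := by positivity
    simp only [Nat.cast_add, Nat.cast_one, Nat.cast_zero, inv_zero, add_zero]
    linarith

/-- Since `|k|` is the smaller of `k` and `n - k`, its inverse is at most the sum of theirs: two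
harmonic sums, plus 1 for `k = 0`. -/
theorem sum_invAbs_le : ∑ k : ZMod n, invAbs k ≤ 3 * (1 + Real.log n) := by
  have hn : 0 < n := NeZero.pos n
  have h1 : ∀ k : ZMod n, invAbs k
      ≤ (if k.val = 0 then 1 else 0) + ((k.val : ℝ)⁻¹ + ((n - k.val : ℕ) : ℝ)⁻¹) := by
    intro k
    unfold invAbs
    by_cases hk : k = 0
    · simp [hk]
    · have hv : k.val ≠ 0 := by rwa [Ne, ZMod.val_eq_zero]
      rw [if_neg hk, if_neg hv, zero_add, ZMod.valMinAbs_natAbs_eq_min]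
      rcases min_choice k.val (n - k.val) with h | h <;> rw [h]
      · have : (0 : ℝ) ≤ ((n - k.val : ℕ) : ℝ)⁻¹ := by positivity
        linarith
      · have : (0 : ℝ) ≤ (k.val : ℝ)⁻¹ := by positivity
        linarith
  have h2 : ∑ k : ZMod n, ((if k.val = 0 then 1 else 0) + ((k.val : ℝ)⁻¹ + ((n - k.val : ℕ) : ℝ)⁻¹))
      = ∑ i ∈ Finset.range n, ((if i = 0 then 1 else 0) + ((i : ℝ)⁻¹ + ((n - i : ℕ) : ℝ)⁻¹)) := by
    refine Finset.sum_nbij' ZMod.val (fun i => (i : ZMod n)) ?_ ?_ ?_ ?_ ?_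
    · intro k _; simp [ZMod.val_lt]
    · intro i _; simp
    · intro k _; simp
    · intro i hi; exact ZMod.val_cast_of_lt (Finset.mem_range.1 hi)
    · intro k _; rfl
  have h3 : ∑ i ∈ Finset.range n, ((n - i : ℕ) : ℝ)⁻¹ ≤ 1 + Real.log n := by
    refine le_trans (le_of_eq ?_) (harmonic_le_one_add_log n)
    rw [harmonic, ← Finset.sum_range_reflect, Rat.cast_sum]
    refine Finset.sum_congr rfl fun i hi => ?_
    rw [Finset.mem_range] at hi
    rw [show n - (n - 1 - i) = i + 1 by omega]
    push_cast
    rfl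
  refine (Finset.sum_le_sum fun k _ => h1 k).trans ?_
  rw [h2, Finset.sum_add_distrib, Finset.sum_add_distrib]
  have h4 := sum_inv_range_le n
  have h5 : ∑ i ∈ Finset.range n, (if i = 0 then (1 : ℝ) else 0) ≤ 1 := by
    rw [Finset.sum_ite_eq']; split_ifs <;> norm_num
  have h6 : 0 ≤ Real.log n := Real.log_natCast_nonneg n
  linarith

end Characters

/-! ### Diagonal of the resolvent in dimensions one and two -/

section Diagonal

variable {d n : ℕ} [NeZero n] {lam C t : ℝ}

/-- The zero mode is counted apart; the sum of the product weights factorises over the coordinates.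
-/
theorem resolventDiag_le_of_forall {s : AddChar (BlockTorus d n) ℂ → ℝ} {A Y : ℝ} (hY : 0 ≤ Y)
    (h : ∀ χ, (1 - t * s χ)⁻¹ ≤ (if frequency χ = 0 then A else 0) +
      Y * ∏ i, invAbs (frequency χ i)) :
    resolventDiag s t ≤ ((n : ℝ) ^ d)⁻¹ * (A + Y * (3 * (1 + Real.log n)) ^ d) := by
  have hcard : (Fintype.card (BlockTorus d n) : ℝ) = (n : ℝ) ^ d := by
    simp [BlockTorus, ZMod.card]
  rw [resolventDiag, hcard]
  refine mul_le_mul_of_nonneg_left ?_ (by positivity)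
  refine (Finset.sum_le_sum fun χ _ => h χ).trans ?_
  rw [frequency_bijective.sum_comp (fun k : Fin d → ZMod n =>
    (if k = 0 then A else 0) + Y * ∏ i, invAbs (k i)), Finset.sum_add_distrib, ← Finset.mul_sum]
  have h1 : ∑ k : Fin d → ZMod n, (if k = 0 then A else 0) = A := by simp
  have h2 : ∑ k : Fin d → ZMod n, ∏ i, invAbs (k i) = (∑ k : ZMod n, invAbs k) ^ d := by
    have := (Finset.prod_univ_sum (fun _ : Fin d => (Finset.univ : Finset (ZMod n)))
      (fun _ k => invAbs k)).symm
    simpa using this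
  rw [h1, h2]
  gcongr
  · exact Finset.sum_nonneg fun k _ => invAbs_nonneg k
  · exact sum_invAbs_le

/-- `1 - t s ≥ (1 - s) / 2` for either sign of `s`, and `λ ≥ 1 / C` keeps the hopping strength away
from zero. -/
theorem one_sub_mul_blockSymbol_ge (hC : 0 < C) (hl : C⁻¹ ≤ lam) (hlC : lam ≤ C) (h0 : 0 ≤ t)
    (h1 : t < 1) (χ : AddChar (BlockTorus d n) ℂ) :
    8 * (C ^ 2 + 2 * d)⁻¹ * ∑ i, ((frequency χ i).valMinAbs.natAbs / n : ℝ) ^ 2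
      ≤ 1 - t * blockSymbol d n lam χ := by
  have hlam : 0 < lam := (inv_pos.2 hC).trans_le hl
  have hs := isSymbol_blockVariance (d := d) (n := n) hlam hlC
  have h2 : (1 - blockSymbol d n lam χ) / 2 ≤ 1 - t * blockSymbol d n lam χ := by
    have := hs.le_one χ
    have h3 := (abs_le.1 (hs.abs_le_one χ)).1
    rcases le_or_gt 0 (blockSymbol d n lam χ) with h | h <;> nlinarith
  refine le_trans ?_ h2
  rw [one_sub_blockSymbol]
  have h3 : (C ^ 2 + 2 * d)⁻¹ ≤ lam ^ 2 * (1 + 2 * (d : ℝ) * lam ^ 2)⁻¹ := by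
    rw [← div_eq_mul_inv, inv_le_iff_one_le_mul₀ (by positivity), div_mul_eq_mul_div,
      le_div_iff₀ (by positivity)]
    have : 1 ≤ lam * C := by
      rw [inv_le_iff_one_le_mul₀ hC] at hl; exact hl
    nlinarith [sq_nonneg (lam * C), sq_nonneg (lam * C - 1)]
  have h4 : 8 * ∑ i, ((frequency χ i).valMinAbs.natAbs / n : ℝ) ^ 2
      ≤ ∑ i : Fin d, (1 - (χ (Pi.single i 1)).re) := by
    rw [Finset.mul_sum]
    exact Finset.sum_le_sum fun i _ => one_sub_re_frequency χ i
  have h5 : 0 ≤ ∑ i, ((frequency χ i).valMinAbs.natAbs / n : ℝ) ^ 2 := by positivity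
  have h6 := mul_le_mul h3 h4 (by positivity) (by positivity)
  linarith

theorem natAbs_valMinAbs_pos {n : ℕ} {k : ZMod n} (hk : k ≠ 0) : (1 : ℝ) ≤ k.valMinAbs.natAbs := by
  have : k.valMinAbs.natAbs ≠ 0 := by simpa using hk
  exact_mod_cast Nat.one_le_iff_ne_zero.2 this

theorem ellT_pos (h1 : t < 1) : 0 < ellT n t := by
  have hn : (0 : ℝ) < n := Nat.cast_pos.2 (NeZero.pos n)
  exact lt_min (Real.rpow_pos_of_pos (abs_pos.2 (by linarith)) _) hn

theorem ellT_mul_sqrt_le {n : ℕ} (h1 : t < 1) : ellT n t * √(1 - t) ≤ 1 := by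
  have hpos : 0 < 1 - t := by linarith
  have h : ellT n t ≤ (√(1 - t))⁻¹ := by
    refine (min_le_left _ _).trans (le_of_eq ?_)
    rw [abs_of_pos hpos, Real.rpow_neg hpos.le, Real.sqrt_eq_rpow]
  calc ellT n t * √(1 - t) ≤ (√(1 - t))⁻¹ * √(1 - t) := by gcongr
    _ = 1 := inv_mul_cancel₀ (Real.sqrt_pos.2 hpos).ne'

/-- For `k ≠ 0` the geometric mean of the lower bounds `1 - t` and `(k / n)²` (up to constants) is
used; its inverse sums to `log n / √(1 - t)` after normalisation, and `√(1 - t) ≥ ℓ (1 - t)`. The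
zero mode gives `1 / (n (1 - t))` with `n ≥ ℓ`. -/
theorem resolventDiag_le_one (hC : 0 < C) (hl : C⁻¹ ≤ lam) (hlC : lam ≤ C) (h0 : 0 ≤ t)
    (h1 : t < 1) :
    resolventDiag (blockSymbol 1 n lam) t
      ≤ (1 + 9 * (C ^ 2 + 2)) * (1 + Real.log n) ^ 2 / (ellT n t ^ 1 * |1 - t|) := by
  have hn : (0 : ℝ) < n := Nat.cast_pos.2 (NeZero.pos n)
  have hpos : 0 < 1 - t := by linarith
  set e := √(1 - t) with he
  have he0 : 0 < e := Real.sqrt_pos.2 hpos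
  have hee : e ^ 2 = 1 - t := Real.sq_sqrt hpos.le
  set g : ℝ := (C ^ 2 + 2)⁻¹ with hg
  have hg0 : 0 < g := by positivity
  have hg1 : g ≤ 1 := inv_le_one_of_one_le₀ (by nlinarith)
  have hlam : 0 < lam := (inv_pos.2 hC).trans_le hl
  have hs := isSymbol_blockVariance (d := 1) (n := n) hlam hlC
  have hmain := resolventDiag_le_of_forall (d := 1) (n := n) (t := t) (s := blockSymbol 1 n lam)
    (A := (1 - t)⁻¹) (Y := n * (g * e)⁻¹) (by positivity) (fun χ => ?_)
  · refine hmain.trans ?_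
    have hlog : 0 ≤ Real.log n := Real.log_natCast_nonneg n
    have hℓ := ellT_pos (n := n) h1
    have hℓ1 := ellT_mul_sqrt_le (n := n) h1
    have hℓn : ellT n t ≤ n := min_le_right _ _
    rw [abs_of_pos hpos, pow_one, pow_one, pow_one, ← hee]
    set ℓ := ellT n t
    have hX : (1 : ℝ) ≤ 1 + Real.log n := by linarith
    set X := 1 + Real.log n
    have e1 : (n : ℝ)⁻¹ * ((e ^ 2)⁻¹ + n * (g * e)⁻¹ * (3 * X))
        = (n * e ^ 2)⁻¹ + 3 * g⁻¹ * X * (1 / e) := by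
      field_simp
    have e2 : g⁻¹ = C ^ 2 + 2 := inv_inv _
    have h3 : (n * e ^ 2)⁻¹ ≤ 1 / (ℓ * e ^ 2) := by
      rw [one_div]; gcongr
    have h4 : 1 / e ≤ 1 / (ℓ * e ^ 2) := by
      refine one_div_le_one_div_of_le (by positivity) ?_
      calc ℓ * e ^ 2 = (ℓ * e) * e := by ring
        _ ≤ 1 * e := by gcongr
        _ = e := one_mul e
    have hXX : X ≤ X ^ 2 := by nlinarith
    have h5 : 3 * g⁻¹ * X ≤ 9 * (C ^ 2 + 2) * X ^ 2 := by
      rw [e2]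
      have : 0 ≤ C ^ 2 + 2 := by positivity
      nlinarith
    rw [e1]
    calc (n * e ^ 2)⁻¹ + 3 * g⁻¹ * X * (1 / e)
        ≤ 1 / (ℓ * e ^ 2) + (9 * (C ^ 2 + 2) * X ^ 2) * (1 / (ℓ * e ^ 2)) := by gcongr
      _ ≤ X ^ 2 * (1 / (ℓ * e ^ 2)) + (9 * (C ^ 2 + 2) * X ^ 2) * (1 / (ℓ * e ^ 2)) := by
          gcongr
          refine le_mul_of_one_le_left (by positivity) (by nlinarith)
      _ = _ := by ring
  · have hp := hs.one_sub_pos h0 h1 χ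
    have hle := hs.one_sub_le h0 χ
    by_cases hk : frequency χ = 0
    · have : 0 ≤ n * (g * e)⁻¹ * ∏ i, invAbs (frequency χ i) :=
        mul_nonneg (by positivity) (Finset.prod_nonneg fun i _ => invAbs_nonneg _)
      rw [if_pos hk]
      have := inv_anti₀ hpos hle
      linarith
    · have hk0 : frequency χ 0 ≠ 0 := fun h => hk (by ext i; rw [Subsingleton.elim i 0, h]; rfl)
      have ha := natAbs_valMinAbs_pos hk0
      have hge := one_sub_mul_blockSymbol_ge hC hl hlC h0 h1 χ
      rw [if_neg hk, zero_add, Fin.prod_univ_one, invAbs, if_neg hk0]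
      rw [Fin.sum_univ_one, Nat.cast_one, mul_one, ← hg] at hge
      set a : ℝ := ((frequency χ 0).valMinAbs.natAbs : ℝ)
      set Z := 1 - t * blockSymbol 1 n lam χ
      -- Geometric mean of the two lower bounds for `Z`.
      have h3 : (g * e * (a / n)) ^ 2 ≤ Z ^ 2 := by
        calc (g * e * (a / n)) ^ 2 = e ^ 2 * (g * (g * (a / n) ^ 2)) := by ring
          _ ≤ Z * (8 * g * (a / n) ^ 2) := by
            rw [hee]
            refine mul_le_mul hle ?_ (by positivity) hp.le
            have : 0 ≤ g * (a / n) ^ 2 := by positivity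
            nlinarith
          _ ≤ Z * Z := by gcongr
          _ = Z ^ 2 := by ring
      have h4 : g * e * (a / n) ≤ Z := le_of_abs_le (abs_le_of_sq_le_sq h3 hp.le)
      have h5 := inv_anti₀ (by positivity) h4
      refine h5.trans (le_of_eq ?_)
      field_simp

/-- For `k ≠ 0` the bound by `|k|² / n²` alone suffices: `|k|² ≥ |k₀| |k₁|` splits the sum into two
harmonic sums, and `log² n` is admissible because `ℓ² (1 - t) ≤ 1`. A vanishing coordinate is
replaced by 1. -/
theorem resolventDiag_le_two (hC : 0 < C) (hl : C⁻¹ ≤ lam) (hlC : lam ≤ C) (h0 : 0 ≤ t)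
    (h1 : t < 1) :
    resolventDiag (blockSymbol 2 n lam) t
      ≤ (1 + 9 * (C ^ 2 + 4)) * (1 + Real.log n) ^ 2 / (ellT n t ^ 2 * |1 - t|) := by
  have hn : (0 : ℝ) < n := Nat.cast_pos.2 (NeZero.pos n)
  have hpos : 0 < 1 - t := by linarith
  set e := √(1 - t) with he
  have he0 : 0 < e := Real.sqrt_pos.2 hpos
  have hee : e ^ 2 = 1 - t := Real.sq_sqrt hpos.le
  set g : ℝ := (C ^ 2 + 4)⁻¹ with hg
  have hg0 : 0 < g := by positivity
  have hlam : 0 < lam := (inv_pos.2 hC).trans_le hl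
  have hs := isSymbol_blockVariance (d := 2) (n := n) hlam hlC
  have hmain := resolventDiag_le_of_forall (d := 2) (n := n) (t := t) (s := blockSymbol 2 n lam)
    (A := (1 - t)⁻¹) (Y := n ^ 2 * g⁻¹) (by positivity) (fun χ => ?_)
  · refine hmain.trans ?_
    have hlog : 0 ≤ Real.log n := Real.log_natCast_nonneg n
    have hℓ := ellT_pos (n := n) h1
    have hℓ1 := ellT_mul_sqrt_le (n := n) h1
    have hℓn : ellT n t ≤ n := min_le_right _ _
    rw [abs_of_pos hpos, ← hee]
    set ℓ := ellT n t
    have hX : (1 : ℝ) ≤ 1 + Real.log n := by linarith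
    set X := 1 + Real.log n
    have e1 : ((n : ℝ) ^ 2)⁻¹ * ((e ^ 2)⁻¹ + n ^ 2 * g⁻¹ * (3 * X) ^ 2)
        = (n ^ 2 * e ^ 2)⁻¹ + 9 * g⁻¹ * X ^ 2 := by
      field_simp
      ring
    have e2 : g⁻¹ = C ^ 2 + 4 := inv_inv _
    have h3 : (n ^ 2 * e ^ 2)⁻¹ ≤ 1 / (ℓ ^ 2 * e ^ 2) := by
      rw [one_div]; gcongr
    have h4 : 1 ≤ 1 / (ℓ ^ 2 * e ^ 2) := by
      rw [one_le_div (by positivity), ← mul_pow]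
      exact pow_le_one₀ (by positivity) hℓ1
    rw [e1, e2]
    calc (n ^ 2 * e ^ 2)⁻¹ + 9 * (C ^ 2 + 4) * X ^ 2
        ≤ 1 / (ℓ ^ 2 * e ^ 2) + (9 * (C ^ 2 + 4) * X ^ 2) * (1 / (ℓ ^ 2 * e ^ 2)) := by
          exact add_le_add h3 (le_mul_of_one_le_right (by positivity) h4)
      _ ≤ X ^ 2 * (1 / (ℓ ^ 2 * e ^ 2)) + (9 * (C ^ 2 + 4) * X ^ 2) * (1 / (ℓ ^ 2 * e ^ 2)) := by
          gcongr
          refine le_mul_of_one_le_left (by positivity) (by nlinarith)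
      _ = _ := by ring
  · have hp := hs.one_sub_pos h0 h1 χ
    have hle := hs.one_sub_le h0 χ
    by_cases hk : frequency χ = 0
    · have : 0 ≤ n ^ 2 * g⁻¹ * ∏ i, invAbs (frequency χ i) :=
        mul_nonneg (by positivity) (Finset.prod_nonneg fun i _ => invAbs_nonneg _)
      rw [if_pos hk]
      have := inv_anti₀ hpos hle
      linarith
    · have hge := one_sub_mul_blockSymbol_ge hC hl hlC h0 h1 χ
      rw [if_neg hk, zero_add, Fin.prod_univ_two, invAbs, invAbs]
      rw [Fin.sum_univ_two, show C ^ 2 + 2 * ((2 : ℕ) : ℝ) = C ^ 2 + 4 by norm_num, ← hg] at hge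
      set Z := 1 - t * blockSymbol 2 n lam χ
      have hfin : ∀ b : ℝ, 0 < b → b ≤ 8 * (((frequency χ 0).valMinAbs.natAbs : ℝ) ^ 2 +
          ((frequency χ 1).valMinAbs.natAbs : ℝ) ^ 2) → Z⁻¹ ≤ n ^ 2 * g⁻¹ * b⁻¹ := by
        intro b hb hb8
        have h4 : g * (b / n ^ 2) ≤ Z := by
          refine le_trans ?_ hge
          calc g * (b / n ^ 2) ≤ g * (8 * (((frequency χ 0).valMinAbs.natAbs : ℝ) ^ 2 +
              ((frequency χ 1).valMinAbs.natAbs : ℝ) ^ 2) / n ^ 2) := by gcongr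
            _ = _ := by ring
        refine (inv_anti₀ (by positivity) h4).trans (le_of_eq ?_)
        field_simp
      by_cases hk0 : frequency χ 0 = 0
      · have hk1 : frequency χ 1 ≠ 0 := fun h => hk (by
          ext i; fin_cases i
          · exact hk0
          · exact h)
        have ha := natAbs_valMinAbs_pos hk1
        rw [if_pos hk0, if_neg hk1, one_mul]
        exact hfin _ (by linarith) (by nlinarith [sq_nonneg ((frequency χ 0).valMinAbs.natAbs : ℝ)])
      · have ha := natAbs_valMinAbs_pos hk0
        by_cases hk1 : frequency χ 1 = 0
        · rw [if_neg hk0, if_pos hk1, mul_one]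
          exact hfin _ (by linarith)
            (by nlinarith [sq_nonneg ((frequency χ 1).valMinAbs.natAbs : ℝ)])
        · have hb := natAbs_valMinAbs_pos hk1
          rw [if_neg hk0, if_neg hk1, ← mul_inv]
          exact hfin _ (by nlinarith)
            (by nlinarith [sq_nonneg (((frequency χ 0).valMinAbs.natAbs : ℝ) -
              ((frequency χ 1).valMinAbs.natAbs : ℝ))])

end Diagonal

/-! ### The semicircle transform at the flow parameters -/

section Semicircle

theorem msc_ofReal {E : ℝ} (hE : |E| ≤ 2) :
    msc (E : ℂ) = ((-E / 2 : ℝ) : ℂ) + ((√(4 - E ^ 2) / 2 : ℝ) : ℂ) * Complex.I := by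
  obtain ⟨h1, h2⟩ := abs_le.1 hE
  have e1 : ((E : ℂ) - 2) ^ (1 / 2 : ℂ) = (√(2 - E) : ℝ) * Complex.I := by
    have : ((E : ℂ) - 2) = ((E - 2 : ℝ) : ℂ) := by push_cast; ring
    rw [this, Complex.ofReal_cpow_of_nonpos (by linarith), Real.sqrt_eq_rpow]
    have h3 : Complex.exp (Real.pi * Complex.I * (1 / 2)) = Complex.I := by
      rw [show (Real.pi * Complex.I * (1 / 2) : ℂ) = Real.pi / 2 * Complex.I by ring,
        Complex.exp_pi_div_two_mul_I]
    rw [h3, Complex.ofReal_cpow (by linarith)]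
    push_cast
    ring_nf
  have e2 : ((E : ℂ) + 2) ^ (1 / 2 : ℂ) = (√(E + 2) : ℝ) := by
    have : ((E : ℂ) + 2) = ((E + 2 : ℝ) : ℂ) := by push_cast; ring
    rw [this, Real.sqrt_eq_rpow, Complex.ofReal_cpow (by linarith)]
    push_cast
    ring_nf
  have e3 : √(4 - E ^ 2) = √(2 - E) * √(E + 2) := by
    rw [← Real.sqrt_mul (by linarith)]; ring_nf
  rw [msc, e1, e2, e3]
  push_cast
  ring

theorem edgeDist_of_abs_le {E : ℝ} (hE : |E| ≤ 2) : edgeDist E = 2 - |E| := by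
  obtain ⟨h1, h2⟩ := abs_le.1 hE
  rw [edgeDist, abs_of_nonpos (by linarith), abs_of_nonneg (by linarith)]
  rcases le_total 0 E with h | h
  · rw [abs_of_nonneg h, min_eq_left (by linarith)]; ring
  · rw [abs_of_nonpos h, min_eq_right (by linarith)]; ring

/-- Inside the spectrum `2 |Im m| = √(4 - E²) = √(κ (2 + |E|))`, with `2 + |E|` between 2 and 4. -/
theorem isFlowPoint_msc {E t : ℝ} (hE : |E| ≤ 2) (h0 : 0 ≤ t) (h1 : t < 1) :
    IsFlowPoint (msc (E : ℂ)) t (√(edgeDist E)) := by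
  have hm := msc_ofReal hE
  have hre : (msc (E : ℂ)).re = -E / 2 := by rw [hm]; simp
  have him : (msc (E : ℂ)).im = √(4 - E ^ 2) / 2 := by rw [hm]; simp
  have hE2 : E ^ 2 ≤ 4 := by nlinarith [sq_abs E, abs_nonneg E]
  have hsq : √(4 - E ^ 2) ^ 2 = 4 - E ^ 2 := Real.sq_sqrt (by linarith)
  have hκ : edgeDist E = 2 - |E| := edgeDist_of_abs_le hE
  have hκ0 : 0 ≤ edgeDist E := by rw [hκ]; linarith
  have ha := abs_nonneg E
  have hEE := sq_abs E
  have h4 : 4 - E ^ 2 = edgeDist E * (2 + |E|) := by rw [hκ]; linarith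
  have habs : |(msc (E : ℂ)).im| = √(4 - E ^ 2) / 2 := by
    rw [him, abs_of_nonneg (by positivity)]
  refine ⟨?_, h0, h1, Real.sqrt_nonneg _, ?_, ?_, ?_⟩
  · rw [← sq_eq_sq₀ (norm_nonneg _) zero_le_one, Complex.sq_norm, Complex.normSq_apply, hre, him]
    nlinarith
  · rw [Real.sqrt_le_left (by norm_num), hκ]; linarith
  · rw [habs, mul_div_cancel₀ _ (two_ne_zero)]
    refine Real.sqrt_le_sqrt ?_
    rw [h4]; nlinarith
  · rw [habs, div_le_iff₀ two_pos, show √(edgeDist E) * 2 = √(edgeDist E * 4) by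
      rw [Real.sqrt_mul hκ0, show (4 : ℝ) = 2 ^ 2 by norm_num, Real.sqrt_sq (by norm_num)]]
    refine Real.sqrt_le_sqrt ?_
    rw [h4]
    exact mul_le_mul_of_nonneg_left (by linarith) hκ0

theorem abs_flowEnergy_le (z : ℂ) : |flowEnergy z| ≤ 2 := by
  rw [flowEnergy, abs_div, abs_mul, abs_neg, abs_two, abs_of_nonneg (norm_nonneg _)]
  refine div_le_of_le_mul₀ (norm_nonneg _) (by norm_num) ?_
  have := Complex.abs_re_le_norm (msc z)
  linarith

theorem cpow_half_pos {w : ℂ} (hw : 0 < w.im) :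
    0 < (w ^ (1 / 2 : ℂ)).re ∧ 0 < (w ^ (1 / 2 : ℂ)).im := by
  have h1 : (w ^ (1 / 2 : ℂ)) ^ 2 = w := by simp
  have h2 : 0 ≤ (w ^ (1 / 2 : ℂ)).re := by
    rw [one_div, Complex.cpow_inv_two_re]; positivity
  have h3 := congrArg Complex.im h1
  rw [sq, Complex.mul_im] at h3
  rcases h2.eq_or_lt with h | h
  · rw [← h] at h3; simp at h3; linarith
  · refine ⟨h, ?_⟩
    by_contra hn
    push Not at hn
    nlinarith

/-- With `p = √(z - 2)` and `q = √(z + 2)` one has `m = -((q - p) / 2)²` and `(q - p)(q + p) = 4`.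
Both roots lie in the open first quadrant, so `|q - p| < |q + p|` and hence `|q - p| < 2`. -/
theorem flowTime_lt_one {z : ℂ} (hz : 0 < z.im) : flowTime z < 1 := by
  obtain ⟨p1, p2⟩ := cpow_half_pos (w := z - 2) (by simpa using hz)
  obtain ⟨q1, q2⟩ := cpow_half_pos (w := z + 2) (by simpa using hz)
  have hp : ((z - 2) ^ (1 / 2 : ℂ)) ^ 2 = z - 2 := by simp
  have hq : ((z + 2) ^ (1 / 2 : ℂ)) ^ 2 = z + 2 := by simp
  rw [flowTime, msc]
  set p := (z - 2) ^ (1 / 2 : ℂ)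
  set q := (z + 2) ^ (1 / 2 : ℂ)
  have hm : (-z + p * q) / 2 = -((q - p) ^ 2 / 4) := by
    linear_combination (1 / 4 : ℂ) * hp + (1 / 4 : ℂ) * hq
  have hprod : ‖q - p‖ * ‖q + p‖ = 4 := by
    rw [← norm_mul, show (q - p) * (q + p) = 4 by linear_combination hq - hp]; simp
  have hlt : ‖q - p‖ ^ 2 < ‖q + p‖ ^ 2 := by
    rw [Complex.sq_norm, Complex.sq_norm, Complex.normSq_apply, Complex.normSq_apply]
    simp only [Complex.sub_re, Complex.sub_im, Complex.add_re, Complex.add_im]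
    nlinarith [mul_pos p1 q1, mul_pos p2 q2]
  have hlt' : ‖q - p‖ < ‖q + p‖ := lt_of_pow_lt_pow_left₀ 2 (norm_nonneg _) hlt
  rw [hm, norm_neg, norm_div, norm_pow, Complex.norm_ofNat]
  have h4 : ‖q - p‖ ^ 2 < 4 := by
    have hpos : 0 < ‖q - p‖ := by
      rcases (norm_nonneg (q - p)).eq_or_lt with h | h
      · rw [← h] at hprod; norm_num at hprod
      · exact h
    nlinarith
  have h5 : 0 ≤ ‖q - p‖ ^ 2 := by positivity
  rw [div_pow, div_lt_one (by norm_num)]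
  nlinarith

end Semicircle

/-! ### Assembly of the estimate -/

theorem eventually_const_mul_one_add_log_pow_le (D C₁ : ℝ) (hC₁ : 0 ≤ C₁) (q : ℕ) {τ : ℝ}
    (hτ : 0 < τ) :
    ∀ᶠ x : ℝ in Filter.atTop, D * (C₁ * (1 + Real.log x) ^ 2) ^ q ≤ x ^ τ := by
  have h := ((isLittleO_log_rpow_rpow_atTop ((2 * q : ℕ) : ℝ) hτ).def
    (c := (|D| * (C₁ * 4) ^ q + 1)⁻¹) (by positivity))
  filter_upwards [h, Filter.eventually_ge_atTop (Real.exp 1)] with x hx hxe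
  have hx0 : 0 < x := (Real.exp_pos 1).trans_le hxe
  have hl : 1 ≤ Real.log x := by rwa [Real.le_log_iff_exp_le hx0]
  rw [Real.rpow_natCast, Real.norm_of_nonneg (by positivity),
    Real.norm_of_nonneg (by positivity), ← div_eq_inv_mul, le_div_iff₀ (by positivity)] at hx
  have h1 : (C₁ * (1 + Real.log x) ^ 2) ^ q ≤ (C₁ * 4) ^ q * Real.log x ^ (2 * q) := by
    rw [pow_mul, ← mul_pow]
    refine pow_le_pow_left₀ (by positivity) ?_ q
    rw [mul_assoc]
    exact mul_le_mul_of_nonneg_left (by nlinarith) hC₁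
  have h2 : 0 ≤ Real.log x ^ (2 * q) := by positivity
  have h3 : 0 ≤ (C₁ * (1 + Real.log x) ^ 2) ^ q := by positivity
  calc D * (C₁ * (1 + Real.log x) ^ 2) ^ q
      ≤ |D| * (C₁ * (1 + Real.log x) ^ 2) ^ q := mul_le_mul_of_nonneg_right (le_abs_self D) h3
    _ ≤ |D| * ((C₁ * 4) ^ q * Real.log x ^ (2 * q)) := by gcongr
    _ ≤ x ^ τ := by linarith

theorem resolventDiag_le {d n : ℕ} [NeZero n] {lam C t : ℝ} (hd : d = 1 ∨ d = 2) (hC : 0 < C)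
    (hl : C⁻¹ ≤ lam) (hlC : lam ≤ C) (h0 : 0 ≤ t) (h1 : t < 1) :
    resolventDiag (blockSymbol d n lam) t
      ≤ (1 + 9 * (C ^ 2 + 2 * d)) * (1 + Real.log n) ^ 2 / (ellT n t ^ d * |1 - t|) := by
  rcases hd with rfl | rfl
  · simpa using resolventDiag_le_one hC hl hlC h0 h1
  · have := resolventDiag_le_two (n := n) hC hl hlC h0 h1
    rwa [show (C ^ 2 + 2 * ((2 : ℕ) : ℝ)) = C ^ 2 + 4 by norm_num]

theorem norm_loopFamily_le {d n : ℕ} [NeZero n] {W : ℕ} {lam c A B E t : ℝ}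
    (hW : W ≠ 0) (hc : 0 < c) (hE : |E| ≤ 2) (h0 : 0 ≤ t) (h1 : t < 1)
    (h : IsSymbol (blockVariance d n lam) (blockSymbol d n lam) c)
    (hB : 0 < B) (hb : resolventDiag (blockSymbol d n lam) t ≤ A / B)
    (w : LoopIndex d n) (hw : 2 ≤ w.length) :
    ‖loopFamily d n W lam (blockSymbol d n lam) (msc (E : ℂ)) t w‖ ≤
      chainConst c (w.length - 2) * A ^ (w.length - 1) *
        (omegaT E t / ((W : ℝ) ^ d * B * omegaT E t) ^ (w.length - 1)) := by
  obtain ⟨p, ⟨σ, x⟩, rfl⟩ := List.eq_nil_or_concat w |>.resolve_left (by rintro rfl; simp at hw)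
  have hF := isFlowPoint_msc hE h0 h1
  simp only [List.concat_eq_append, List.length_append, List.length_singleton] at hw ⊢
  obtain ⟨q, hq⟩ : ∃ q, p.length = q + 1 := ⟨p.length - 1, by omega⟩
  have hchain := hF.norm_chain_le h p σ (by omega) x
  rw [loopFamily_append, norm_mul, norm_pow, norm_inv, norm_pow, Complex.norm_natCast]
  have hω : omegaT E t = 1 - t + √(edgeDist E) := by
    rw [omegaT, abs_of_pos (by linarith)]
  have hω0 : 0 < omegaT E t := by
    rw [hω]; linarith [Real.sqrt_nonneg (edgeDist E)]
  rw [← hω, hq] at hchain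
  rw [hq, show q + 1 + 1 - 2 = q by omega, Nat.add_sub_cancel]
  rw [Nat.add_sub_cancel] at hchain
  have hD := chainConst_nonneg hc q
  have hb0 := h.resolventDiag_nonneg h0 h1
  have hWp : (0 : ℝ) < (W : ℝ) ^ d := by positivity
  set b := resolventDiag (blockSymbol d n lam) t
  set ω := omegaT E t
  calc (((W : ℝ) ^ d)⁻¹) ^ (q + 1) * _
      ≤ (((W : ℝ) ^ d)⁻¹) ^ (q + 1) * (chainConst c q * (b / ω) ^ q * b) := by gcongr
    _ ≤ (((W : ℝ) ^ d)⁻¹) ^ (q + 1) * (chainConst c q * (A / B / ω) ^ q * (A / B)) := by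
        have hAB : 0 ≤ A / B := hb0.trans hb
        gcongr
    -- Rearranges `b (b / ω) ^ q` as `ω (b / ω) ^ (q + 1)`, the form in which the loop bound is
    -- stated.
    _ = _ := by
        generalize (W : ℝ) ^ d = V at hWp ⊢
        rw [inv_pow, div_pow, div_pow, mul_pow, mul_pow, pow_succ V, pow_succ A, pow_succ B,
          pow_succ ω]
        field_simp

end

theorem lemma3p9 (d : ℕ) (hd : d = 1 ∨ d = 2) (r : ℕ) (hr : 2 ≤ r)
    (C C₀ δ b c τ : ℝ) (hC : 0 < C) (hC₀ : 2 < C₀) (hδ : 0 < δ) (hb : 0 < b) (hc : 0 < c)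
    (hτ : 0 < τ) :
    ∃ N₀ : ℕ, ∀ (n W : ℕ) [NeZero n] (lam : ℝ) (z : ℂ),
      Odd n → Odd W → N₀ ≤ (n * W) ^ d → ((n * W : ℕ) : ℝ) ^ δ ≤ (W : ℝ) →
      C⁻¹ ≤ lam → lam ≤ C → z ∈ spectralDomain d n W C₀ b c →
      ∃ K : ℝ → LoopIndex d n → ℂ,
        IsPrimitiveLoopFamily W lam (msc (flowEnergy z : ℂ)) K ∧
        (∀ K' : ℝ → LoopIndex d n → ℂ,
          IsPrimitiveLoopFamily W lam (msc (flowEnergy z : ℂ)) K' →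
          ∀ t ∈ Set.Ico (0 : ℝ) 1, ∀ w : LoopIndex d n, w ≠ [] → K' t w = K t w) ∧
        ∀ t ∈ Set.Icc (0 : ℝ) (flowTime z), ∀ w : LoopIndex d n, w.length = r →
          ‖K t w‖ ≤ (((n * W) ^ d : ℕ) : ℝ) ^ τ *
            (omegaT (flowEnergy z) t /
              ((W : ℝ) ^ d * ellT n t ^ d * |1 - t| * omegaT (flowEnergy z) t) ^ (r - 1)) := by
  set c₀ : ℝ := 2 / (1 + 2 * (d : ℝ) * C ^ 2) with hc₀
  have hc₀' : 0 < c₀ := by positivity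
  set C₁ : ℝ := 1 + 9 * (C ^ 2 + 2 * d) with hC₁
  have hC₁' : 0 ≤ C₁ := by positivity
  obtain ⟨x₀, hx₀⟩ := Filter.eventually_atTop.1
    (eventually_const_mul_one_add_log_pow_le (chainConst c₀ (r - 2)) C₁ hC₁' (r - 1) hτ)
  -- Beyond `x₀` the chain constant and all logarithms are absorbed by `N ^ τ`; `x₀` depends only on
  -- `d`, `r`, `C` and `τ`.
  refine ⟨⌈x₀⌉₊, fun n W _ lam z _ hW hN _ hl hlC hz => ?_⟩
  have hW0 : W ≠ 0 := hW.pos.ne'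
  have hlam : 0 < lam := (inv_pos.2 hC).trans_le hl
  have h := isSymbol_blockVariance (d := d) (n := n) hlam hlC
  have hE := abs_flowEnergy_le z
  have hK := isPrimitiveLoopFamily_loopFamily hW0 h (isFlowPoint_msc hE le_rfl zero_lt_one).norm_eq
  refine ⟨_, hK, fun K' hK' t ht w hw => hK.eq hK' w.length t ht w hw le_rfl, ?_⟩
  rintro t ⟨h0, ht⟩ w rfl
  have h1 : t < 1 := ht.trans_lt (flowTime_lt_one hz.1)
  have hpos : 0 < |1 - t| := abs_pos.2 (by linarith)
  have hℓ := ellT_pos (n := n) h1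
  have hb' := resolventDiag_le (n := n) hd hC hl hlC h0 h1
  have hmain := norm_loopFamily_le hW0 hc₀' hE h0 h1 h (by positivity) hb' w hr
  have hω : 0 ≤ omegaT (flowEnergy z) t := by unfold omegaT; positivity
  rw [← mul_assoc ((W : ℝ) ^ d)] at hmain
  refine hmain.trans (mul_le_mul_of_nonneg_right ?_ (by positivity))
  refine le_trans ?_ (hx₀ (((n * W) ^ d : ℕ) : ℝ) (Nat.ceil_le.1 hN))
  have hn : 1 ≤ n := NeZero.one_le
  -- The logarithm in the resolvent bound is of `n`, the absorbing power is of `N`.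
  have hnN : n ≤ (n * W) ^ d := (Nat.le_mul_of_pos_right n hW.pos).trans
    (Nat.le_self_pow (by omega) _)
  have hlog : Real.log n ≤ Real.log (((n * W) ^ d : ℕ) : ℝ) :=
    Real.log_le_log (by exact_mod_cast hn) (by exact_mod_cast hnN)
  have hlog0 : 0 ≤ Real.log n := Real.log_natCast_nonneg n
  have hD := chainConst_nonneg hc₀' (w.length - 2)
  gcongr
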